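/- Let $H\neq\{0\}$ be a countable discrete abelian group, $\mu:H\times H\to\mathbb T=\{z\in\mathbb C:|z|=1\}$ a normalized scalar $2$-cocycle ($\mu(g,h)\mu(g+h,k)=\mu(h,k)\mu(g,h+k)$ and $\mu(g,0)=1=\mu(0,g)$), and $\chi:H\to\mathbb T$ a character. **Notation.** Let $\Lambda(H)$ be the group of finitely supported $\lambda:\mathbb Z^2\to H$ with $\sum_{k}\lambda(k)=0$, with the $2$-cocycle $\widetilde\mu(\lambda_1,\lambda_2)=\prod_{k\in\mathbb Z^2}\mu(\lambda_1(k),\lambda_2(k))$. Let $N(H,\mu)=L_{\widetilde\mu}(\Lambda(H))$ be the twisted group von Neumann algebra, generated by the unitaries $u(\lambda)$ on $\ell^2(\Lambda(H))$, $u(\lambda)\delta_{\lambda'}=\widetilde\mu(\lambda,\lambda')\delta_{\lambda+\lambda'}$, with trace $\mathrm{tr}(x)=\langle x\delta_0,\delta_0\rangle$ and $2$-norm $\|x\|_2=\mathrm{tr}(x^*x)^{1/2}$. The group $\mathbb Z^2\rtimes SL(2,\mathbb Z)$ acts on $\mathbb Z^2$ by $(k,\gamma)\cdot m=k+\gamma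 m$ and on $\Lambda(H)$ by $(p\cdot\lambda)(m)=\lambda(p^{-1}\cdot m)$. The twisted Bernoulli shift action $\beta=\beta(H,\mu,\chi)$ of $\mathbb Z^2\rtimes SL(2,\mathbb Z)$ on $N(H,\mu)$ is the action by $*$-automorphisms, implemented by unitaries of $\ell^2(\Lambda(H))$, with $$\beta(k,\gamma)(u(\lambda))=\Big(\prod_{m\in\mathbb Z^2}\chi\big((\gamma\cdot\lambda)(m)\big)^{\det(k,m)}\Big)\,u\big((k,\gamma)\cdot\lambda\big),\qquad \det(k,m)=k_1m_2-k_2m_1 .$$ Let $\mathrm{Aut}(N(H,\mu),\beta)$ be the group of $*$-automorphisms of $N(H,\mu)$ that commute with every $\beta(k,\gamma)$, with the topology of pointwise convergence in $\|\cdot\|_2$. Let $\mu^*\mu(g,h)=\overline{\mu(h,g)}\,\mu(g,h)$, and let $\mathrm{Aut}(H,\mu^*\mu,\chi^2)$ be the group of automorphisms $\phi$ of $H$ with $\mu^*\mu(\phi(g),\phi(h))=\mu^*\mu(g,h)$ and $\chi(\phi(g))^2=\chi(g)^2$ for all $g,h\in H$, with the topology of pointwise convergence ($H$ discrete). **Theorem.**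 For every $\pi\in\mathrm{Aut}(N(H,\mu),\beta(H,\mu,\chi))$ there is a unique $\phi=\phi_\pi\in\mathrm{Aut}(H,\mu^*\mu,\chi^2)$ such that for every $\lambda\in\Lambda(H)$ there is $z\in\mathbb T$ with $\pi(u(\lambda))=z\,u(\phi\circ\lambda)$. Both $\mathrm{Aut}(N(H,\mu),\beta(H,\mu,\chi))$ and $\mathrm{Aut}(H,\mu^*\mu,\chi^2)$ are topological groups, and the map $\pi\mapsto\phi_\pi$ is an isomorphism of topological groups (a group isomorphism and a homeomorphism) $$\mathrm{Aut}(N(H,\mu),\beta(H,\mu,\chi))\;\cong\;\mathrm{Aut}(H,\mu^*\mu,\chi^2).$$ -/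

import Mathlib

open scoped MatrixGroups

noncomputable section

namespace TwistedBernoulli

/-! ### Scalar 2-cocycles -/

/-- A normalized scalar `2`-cocycle of an abelian group, with values in the unit circle
(the group acts trivially on the circle). -/
structure Cocycle (G : Type*) [AddCommGroup G] where
  toFun : G → G → Circle
  cocycle' : ∀ g h k, toFun g h * toFun (g + h) k = toFun h k * toFun g (h + k)
  zero_left' : ∀ g, toFun 0 g = 1
  zero_right' : ∀ g, toFun g 0 = 1

instance {G : Type*} [AddCommGroup G] : CoeFun (Cocycle G) (fun _ => G → G → Circle) :=
  ⟨Cocycle.toFun⟩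

/-- The function `μ*μ (g, h) = conj (μ (h, g)) * μ (g, h)`. -/
def Cocycle.starMul {G : Type*} [AddCommGroup G] (μ : Cocycle G) (g h : G) : Circle :=
  (μ h g)⁻¹ * μ g h

/-- The restriction of a cocycle to a subgroup. -/
def Cocycle.restrict {G : Type*} [AddCommGroup G] (μ : Cocycle G) (L : AddSubgroup G) :
    Cocycle L where
  toFun g h := μ g h
  cocycle' g h k := μ.cocycle' g h k
  zero_left' g := μ.zero_left' g
  zero_right' g := μ.zero_right' g

/-! ### Monomial unitaries on `ℓ²` -/

/-- The Hilbert space `ℓ²(X)`. -/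
abbrev L2 (X : Type*) := lp (fun _ : X => ℂ) 2

lemma memlp_monomial {X : Type*} (e : Equiv.Perm X) (w : X → Circle) (f : L2 X) :
    Memℓp (fun x => (w (e.symm x) : ℂ) * f (e.symm x)) 2 := by
  have h := (memℓp_gen_iff (p := 2) (by simp)).1 (lp.memℓp f)
  refine (memℓp_gen_iff (p := 2) (by simp)).2 ?_
  have := (e.symm.summable_iff).2 h
  refine this.congr fun x => ?_
  change ‖f (e.symm x)‖ ^ _ = ‖(w (e.symm x) : ℂ) * f (e.symm x)‖ ^ _
  rw [norm_mul, Circle.norm_coe, one_mul]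

/-- The unitary of `ℓ²(X)` with `δ_x ↦ w(x) δ_{e(x)}`, as a linear isometric isomorphism. -/
def monomialIso {X : Type*} (e : Equiv.Perm X) (w : X → Circle) : L2 X ≃ₗᵢ[ℂ] L2 X where
  toFun f := ⟨fun x => (w (e.symm x) : ℂ) * f (e.symm x), memlp_monomial e w f⟩
  invFun f := ⟨fun x => ((w x)⁻¹ : Circle) * f (e x),
    by
      have h := memlp_monomial e.symm (fun x => (w (e.symm x))⁻¹) f
      simp only [Equiv.symm_symm, Equiv.symm_apply_apply] at h
      exact h⟩
  map_add' f g := by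
    ext x
    exact mul_add _ _ _
  map_smul' c f := by
    ext x
    simp [mul_left_comm]
  left_inv f := by
    ext x
    simp
  right_inv f := by
    ext x
    simp
  norm_map' f := by
    simp only [LinearEquiv.coe_mk, LinearMap.coe_mk, AddHom.coe_mk]
    rw [lp.norm_eq_tsum_rpow (by simp), lp.norm_eq_tsum_rpow (by simp)]
    congr 1
    rw [← e.symm.tsum_eq (fun i => ‖f i‖ ^ _)]
    refine tsum_congr fun x => ?_
    change ‖(w (e.symm x) : ℂ) * f (e.symm x)‖ ^ _ = ‖f (e.symm x)‖ ^ _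
    rw [norm_mul, Circle.norm_coe, one_mul]

/-- The unitary operator on `ℓ²(X)` with `δ_x ↦ w(x) δ_{e(x)}`. -/
def monomial {X : Type*} (e : Equiv.Perm X) (w : X → Circle) : unitary (L2 X →L[ℂ] L2 X) :=
  Unitary.linearIsometryEquiv.symm (monomialIso e w)

lemma monomial_apply {X : Type*} (e : Equiv.Perm X) (w : X → Circle) (f : L2 X) (x : X) :
    (monomial e w : L2 X →L[ℂ] L2 X) f x = w (e.symm x) * f (e.symm x) := rfl

lemma monomial_ext {X : Type*} {a b : unitary (L2 X →L[ℂ] L2 X)}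
    (h : ∀ f x, (a : L2 X →L[ℂ] L2 X) f x = (b : L2 X →L[ℂ] L2 X) f x) : a = b := by
  ext f x
  exact h f x

lemma monomial_mul {X : Type*} (e e' : Equiv.Perm X) (w w' : X → Circle) :
    monomial e w * monomial e' w' = monomial (e * e') (fun x => w (e' x) * w' x) := by
  refine monomial_ext fun f x => ?_
  have h1 : ((monomial e w * monomial e' w' : unitary (L2 X →L[ℂ] L2 X)) : L2 X →L[ℂ] L2 X) f
      = (monomial e w : L2 X →L[ℂ] L2 X) ((monomial e' w' : L2 X →L[ℂ] L2 X) f) := rfl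
  rw [h1, monomial_apply, monomial_apply, monomial_apply]
  have h2 : (e * e').symm x = e'.symm (e.symm x) := rfl
  simp [h2, mul_assoc]

open Classical in
/-- The canonical orthonormal basis vector `δ_x` of `ℓ²(X)`. -/
def delta {X : Type*} (x : X) : L2 X := lp.single 2 x 1

/-! ### Twisted group von Neumann algebras -/

/-- The unitary `u(g)` on `ℓ²(G)`, with `u(g) δ_h = μ(g, h) δ_{g + h}`. -/
def u {G : Type*} [AddCommGroup G] (μ : Cocycle G) (g : G) : unitary (L2 G →L[ℂ] L2 G) :=
  monomial (Equiv.addLeft g) (fun h => μ g h)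

/-- The twisted group von Neumann algebra `L_μ(G)`: the double commutant of `{u(g)}`. -/
def groupVN {G : Type*} [AddCommGroup G] (μ : Cocycle G) : VonNeumannAlgebra (L2 G) where
  toStarSubalgebra := StarSubalgebra.centralizer ℂ
    (StarSubalgebra.centralizer ℂ
      (Set.range fun g => (u μ g : L2 G →L[ℂ] L2 G)) : Set (L2 G →L[ℂ] L2 G))
  centralizer_centralizer' := by
    have h : (StarSubalgebra.centralizer ℂ (StarSubalgebra.centralizer ℂ
        (Set.range fun g => (u μ g : L2 G →L[ℂ] L2 G)) : Set (L2 G →L[ℂ] L2 G))).carrier =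
        Set.centralizer (_ ∪ _) := StarSubalgebra.coe_centralizer ℂ _
    rw [h]
    exact Set.centralizer_centralizer_centralizer _

/-- The `*`-algebra underlying `L_μ(G)`. -/
abbrev LVN {G : Type*} [AddCommGroup G] (μ : Cocycle G) := ↥(groupVN μ).toStarSubalgebra

lemma mem_groupVN {G : Type*} [AddCommGroup G] {μ : Cocycle G} {x : L2 G →L[ℂ] L2 G} :
    x ∈ (groupVN μ).toStarSubalgebra ↔ ∀ y : L2 G →L[ℂ] L2 G,
      (∀ g, (u μ g : L2 G →L[ℂ] L2 G) * y = y * u μ g ∧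
        star (u μ g : L2 G →L[ℂ] L2 G) * y = y * star (u μ g : L2 G →L[ℂ] L2 G)) →
      y * x = x * y := by
  have key : ∀ y : L2 G →L[ℂ] L2 G, y ∈ StarSubalgebra.centralizer ℂ
      (Set.range fun g => (u μ g : L2 G →L[ℂ] L2 G)) ↔
      ∀ g, (u μ g : L2 G →L[ℂ] L2 G) * y = y * u μ g ∧
        star (u μ g : L2 G →L[ℂ] L2 G) * y = y * star (u μ g : L2 G →L[ℂ] L2 G) := by
    intro y
    rw [StarSubalgebra.mem_centralizer_iff]
    exact Set.forall_mem_range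
  have h : x ∈ (groupVN μ).toStarSubalgebra ↔ _ := StarSubalgebra.mem_centralizer_iff ℂ
  rw [h]
  constructor
  · intro hx y hy
    exact (hx y ((key y).2 hy)).1
  · intro hx y hy
    exact ⟨hx y ((key y).1 hy), hx _ ((key _).1 (star_mem hy))⟩

lemma u_mem {G : Type*} [AddCommGroup G] (μ : Cocycle G) (g : G) :
    (u μ g : L2 G →L[ℂ] L2 G) ∈ (groupVN μ).toStarSubalgebra :=
  mem_groupVN.2 fun _ hy => ((hy g).1).symm

/-- The unitary `u(g)` as an element of `L_μ(G)`. -/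
def U {G : Type*} [AddCommGroup G] (μ : Cocycle G) (g : G) : LVN μ := ⟨u μ g, u_mem μ g⟩

/-- The trace `tr(x) = ⟨x δ_0, δ_0⟩` (Mathlib's inner product is linear in the second variable). -/
def tr {G : Type*} [AddCommGroup G] (μ : Cocycle G) (x : LVN μ) : ℂ :=
  inner ℂ (delta (0 : G)) ((x : L2 G →L[ℂ] L2 G) (delta 0))

lemma sqrt_tr {G : Type*} [AddCommGroup G] (μ : Cocycle G) (x : LVN μ) :
    √(tr μ (star x * x)).re = ‖(x : L2 G →L[ℂ] L2 G) (delta 0)‖ := by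
  have : tr μ (star x * x) = inner ℂ ((x : L2 G →L[ℂ] L2 G) (delta 0))
      ((x : L2 G →L[ℂ] L2 G) (delta 0)) := by
    simp [tr, ContinuousLinearMap.star_eq_adjoint, ContinuousLinearMap.adjoint_inner_right]
  rw [this, ← RCLike.re_eq_complex_re, ← norm_eq_sqrt_re_inner]

/-- The `2`-norm `‖x‖₂ = tr(x* x)^{1/2}` on `L_μ(G)`. -/
def twoNorm {G : Type*} [AddCommGroup G] (μ : Cocycle G) : AddGroupSeminorm (LVN μ) where
  toFun x := √(tr μ (star x * x)).re
  map_zero' := by simp [tr]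
  add_le' x y := by
    simp only [sqrt_tr]
    exact norm_add_le ((x : L2 G →L[ℂ] L2 G) (delta 0)) ((y : L2 G →L[ℂ] L2 G) (delta 0))
  neg' x := by simp

/-- The topology of the `2`-norm on `L_μ(G)`. -/
@[reducible] def twoNormTopology {G : Type*} [AddCommGroup G] (μ : Cocycle G) : TopologicalSpace (LVN μ) :=
  (twoNorm μ).toSeminormedAddCommGroup.toPseudoMetricSpace.toUniformSpace.toTopologicalSpace

/-- The group of `*`-automorphisms of `L_μ(G)`. -/
abbrev AutVN {G : Type*} [AddCommGroup G] (μ : Cocycle G) := LVN μ ≃⋆ₐ[ℂ] LVN μ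

/-- The topology of pointwise convergence in `2`-norm on the automorphisms of `L_μ(G)`: the coarsest
one for which every evaluation `α ↦ α x` is continuous for the `2`-norm. -/
instance {G : Type*} [AddCommGroup G] (μ : Cocycle G) : TopologicalSpace (AutVN μ) :=
  ⨅ x : LVN μ, TopologicalSpace.induced (fun α : AutVN μ => α x) (twoNormTopology μ)

/-! ### Automorphisms implemented by monomial unitaries -/

lemma monomial_conj_u {G : Type*} [AddCommGroup G] (μ : Cocycle G) (e : G ≃+ G)
    (he : ∀ g h, μ (e g) (e h) = μ g h) (c : AddChar G Circle) (g : G) :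
    (monomial e.toEquiv c : L2 G →L[ℂ] L2 G) * u μ g =
      (c g : ℂ) • ((u μ (e g) : L2 G →L[ℂ] L2 G) * monomial e.toEquiv c) := by
  ext f x
  have hl : ((monomial e.toEquiv c : L2 G →L[ℂ] L2 G) * u μ g) f x =
      (monomial e.toEquiv c : L2 G →L[ℂ] L2 G) ((u μ g : L2 G →L[ℂ] L2 G) f) x := rfl
  have hr : ((c g : ℂ) • ((u μ (e g) : L2 G →L[ℂ] L2 G) * monomial e.toEquiv c)) f x =
      (c g : ℂ) * (u μ (e g) : L2 G →L[ℂ] L2 G)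
        ((monomial e.toEquiv c : L2 G →L[ℂ] L2 G) f) x := rfl
  rw [hl, hr]
  simp only [u, monomial_apply]
  obtain ⟨y, rfl⟩ := e.surjective x
  have h1 : e.toEquiv.symm (e y) = y := e.symm_apply_apply y
  have h2 : (Equiv.addLeft (e g)).symm (e y) = e (y - g) := by
    simp [sub_eq_neg_add]
  have h3 : (Equiv.addLeft g).symm y = y - g := by
    simp [sub_eq_neg_add]
  have h4 : e.toEquiv.symm (e (y - g)) = y - g := e.symm_apply_apply _
  have h5 : c y = c g * c (y - g) := by
    rw [← AddChar.map_add_eq_mul]; simp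
  rw [h1, h2, h3, h4, he, h5]
  push_cast
  ring

lemma conj_mem {G : Type*} [AddCommGroup G] (μ : Cocycle G) (e : G ≃+ G)
    (he : ∀ g h, μ (e g) (e h) = μ g h) (c : AddChar G Circle) {x : L2 G →L[ℂ] L2 G}
    (hx : x ∈ (groupVN μ).toStarSubalgebra) :
    Unitary.conjStarAlgAut ℂ (L2 G →L[ℂ] L2 G) (monomial e.toEquiv c) x ∈
      (groupVN μ).toStarSubalgebra := by
  rw [mem_groupVN] at hx ⊢
  intro y hy
  set Φ := Unitary.conjStarAlgAut ℂ (L2 G →L[ℂ] L2 G) (monomial e.toEquiv c) with hΦ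
  have hu : ∀ g, Φ (u μ g) = (c g : ℂ) • (u μ (e g) : L2 G →L[ℂ] L2 G) := by
    intro g
    rw [hΦ, Unitary.conjStarAlgAut_apply, monomial_conj_u μ e he c g, smul_mul_assoc, mul_assoc]
    simp
  have h := hx (Φ.symm y) fun g => by
    constructor
    · refine EquivLike.injective Φ ?_
      rw [map_mul, map_mul, hu, StarAlgEquiv.apply_symm_apply, smul_mul_assoc, mul_smul_comm,
        (hy _).1]
    · refine EquivLike.injective Φ ?_
      rw [map_mul, map_mul, map_star, hu, StarAlgEquiv.apply_symm_apply, star_smul,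
        smul_mul_assoc, mul_smul_comm, (hy _).2]
  have := congrArg Φ h
  simpa using this

/-! ### The group `ℤ² ⋊ SL(2, ℤ)` and the base algebra -/

/-- `ℤ²`. -/
abbrev Z2 := Fin 2 → ℤ

/-- `SL(2, ℤ)` acting on `ℤ²` by matrix multiplication. -/
def slAut : SL(2, ℤ) →* MulAut (Multiplicative Z2) where
  toFun A := AddEquiv.toMultiplicative (Matrix.SpecialLinearGroup.toLin' A).toAddEquiv
  map_one' := by
    ext1 x
    simp
  map_mul' A B := by
    ext1 x
    simp

/-- The group `ℤ² ⋊ SL(2, ℤ)`. -/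
abbrev Gam := Multiplicative Z2 ⋊[slAut] SL(2, ℤ)

/-- The affine action of `ℤ² ⋊ SL(2, ℤ)` on `ℤ²`: `(k, γ) · m = k + γ m`. -/
instance : MulAction Gam Z2 where
  smul p m := p.left.toAdd + p.right.1.mulVec m
  one_smul m := by
    change (1 : Gam).left.toAdd + (1 : Gam).right.1.mulVec m = m
    simp
  mul_smul p q m := by
    change (p * q).left.toAdd + (p * q).right.1.mulVec m =
      p.left.toAdd + p.right.1.mulVec (q.left.toAdd + q.right.1.mulVec m)
    have h : (p * q).left.toAdd = p.left.toAdd + p.right.1.mulVec q.left.toAdd := rfl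
    rw [h, Matrix.mulVec_add, Matrix.mulVec_mulVec, add_assoc]
    rfl

lemma gam_smul_def (p : Gam) (m : Z2) : p • m = p.left.toAdd + p.right.1.mulVec m := rfl

/-- `det(k, l) = k₁ l₂ - k₂ l₁` on `ℤ²`. -/
def det2 (k l : Z2) : ℤ := k 0 * l 1 - k 1 * l 0

lemma det2_add_left (k k' l : Z2) : det2 (k + k') l = det2 k l + det2 k' l := by
  simp [det2]; ring

lemma det2_add_right (k l l' : Z2) : det2 k (l + l') = det2 k l + det2 k l' := by
  simp [det2]; ring

lemma det2_mulVec (A : SL(2, ℤ)) (k l : Z2) :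
    det2 (A.1.mulVec k) (A.1.mulVec l) = det2 k l := by
  have h := A.2
  rw [Matrix.det_fin_two] at h
  simp only [det2, Matrix.mulVec, dotProduct, Fin.sum_univ_two]
  linear_combination (k 0 * l 1 - k 1 * l 0) * h

section

variable (H : Type*) [AddCommGroup H]

/-- The group `Λ(H)` of finitely supported `λ : ℤ² → H` with `∑ λ(k) = 0`, as a subgroup of
`⊕_{ℤ²} H`. -/
def Lam : AddSubgroup (Z2 →₀ H) where
  carrier := {l | ∑ᶠ k, l k = 0}
  zero_mem' := by simp
  add_mem' {a b} ha hb := by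
    change ∑ᶠ k, a k = 0 at ha
    change ∑ᶠ k, b k = 0 at hb
    change ∑ᶠ k, (a k + b k) = 0
    rw [finsum_add_distrib a.hasFiniteSupport b.hasFiniteSupport, ha, hb, add_zero]
  neg_mem' {a} ha := by
    change ∑ᶠ k, a k = 0 at ha
    change ∑ᶠ k, -a k = 0
    rw [finsum_neg_distrib, ha, neg_zero]

variable {H}

/-- The action of `ℤ² ⋊ SL(2, ℤ)` on `Λ(H)`: `(p · λ)(k) = λ(p⁻¹ · k)`. -/
def act (p : Gam) : Lam H ≃+ Lam H where
  toFun l := ⟨Finsupp.domCongr (MulAction.toPerm p) l.1, by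
    have h : ∑ᶠ k, l.1 k = 0 := l.2
    change ∑ᶠ k, l.1 ((MulAction.toPerm p).symm k) = 0
    rw [← h]
    exact finsum_comp_equiv (f := fun k => l.1 k) (MulAction.toPerm p).symm⟩
  invFun l := ⟨Finsupp.domCongr (MulAction.toPerm p⁻¹) l.1, by
    have h : ∑ᶠ k, l.1 k = 0 := l.2
    change ∑ᶠ k, l.1 ((MulAction.toPerm p⁻¹).symm k) = 0
    rw [← h]
    exact finsum_comp_equiv (f := fun k => l.1 k) (MulAction.toPerm p⁻¹).symm⟩
  left_inv l := by
    ext k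
    simp
  right_inv l := by
    ext k
    simp
  map_add' a b := by
    ext k
    simp

lemma act_apply (p : Gam) (l : Lam H) (k : Z2) : (act p l).1 k = l.1 (p⁻¹ • k) := rfl

/-- The cocycle `μ~(λ₁, λ₂) = ∏_k μ(λ₁(k), λ₂(k))` of `⊕_{ℤ²} H`. -/
def tilde (μ : Cocycle H) : Cocycle (Z2 →₀ H) where
  toFun a b := ∏ᶠ k, μ (a k) (b k)
  cocycle' a b c := by
    have h : ∀ a b : Z2 →₀ H, Function.HasFiniteMulSupport fun k => μ (a k) (b k) := by
      intro a b
      refine a.hasFiniteSupport.subset fun k hk => ?_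
      contrapose! hk
      simp only [Function.mem_support, not_not] at hk
      simp [hk, μ.zero_left']
    rw [← finprod_mul_distrib (h a b) (h (a + b) c), ← finprod_mul_distrib (h b c) (h a (b + c))]
    exact finprod_congr fun k => μ.cocycle' _ _ _
  zero_left' a := by simp [μ.zero_left']
  zero_right' a := by simp [μ.zero_right']

/-- The cocycle `μ~` on `Λ(H)`. -/
def tildeLam (μ : Cocycle H) : Cocycle (Lam H) := (tilde μ).restrict (Lam H)

lemma tildeLam_act (μ : Cocycle H) (p : Gam) (a b : Lam H) :
    tildeLam μ (act p a) (act p b) = tildeLam μ a b :=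
  finprod_comp_equiv (f := fun k => μ (a.1 k) (b.1 k)) (MulAction.toPerm p).symm

/-- The finite von Neumann algebra `N(H, μ) = L_{μ~}(Λ(H))`. -/
abbrev N (μ : Cocycle H) := LVN (tildeLam μ)

/-- The weight `∏_m χ((γ · λ)(m)) ^ det(k, m)`, where `p = (k, γ)` (and `γ` is identified with
`(0, γ)`). -/
def wt (χ : AddChar H Circle) (p : Gam) : AddChar (Lam H) Circle where
  toFun l := ∏ᶠ m, χ ((act (SemidirectProduct.inr p.right) l).1 m) ^ det2 p.left.toAdd m
  map_zero_eq_one' := by simp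
  map_add_eq_mul' a b := by
    have h : ∀ a : Z2 →₀ H,
        Function.HasFiniteMulSupport fun m => χ (a m) ^ det2 p.left.toAdd m := by
      intro a
      refine a.hasFiniteSupport.subset fun k hk => ?_
      contrapose! hk
      simp only [Function.mem_support, not_not] at hk
      simp [hk]
    rw [← finprod_mul_distrib (h _) (h _)]
    refine finprod_congr fun m => ?_
    rw [map_add, ← mul_zpow, ← AddChar.map_add_eq_mul]
    rfl

lemma wt_eq (χ : AddChar H Circle) (p : Gam) (l : Lam H) :
    wt χ p l = ∏ᶠ m, χ (l.1 m) ^ det2 p.left.toAdd (p.right.1.mulVec m) := by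
  have h := finprod_comp_equiv
    (f := fun m => χ ((act (SemidirectProduct.inr p.right) l).1 m) ^ det2 p.left.toAdd m)
    (MulAction.toPerm (SemidirectProduct.inr p.right : Gam))
  refine h.symm.trans (finprod_congr fun m => ?_)
  rw [act_apply, MulAction.toPerm_apply, inv_smul_smul, gam_smul_def]
  simp

lemma wt_mul (χ : AddChar H Circle) (p q : Gam) (l : Lam H) :
    wt χ (p * q) l = wt χ p (act q l) * wt χ q l := by
  have hfin : ∀ (a : Z2 →₀ H) (n : Z2 → ℤ),
      Function.HasFiniteMulSupport fun m => χ (a m) ^ n m := by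
    intro a n
    refine a.hasFiniteSupport.subset fun k hk => ?_
    contrapose! hk
    simp only [Function.mem_support, not_not] at hk
    simp [hk]
  set n : ℤ := det2 p.left.toAdd (p.right.1.mulVec q.left.toAdd) with hn
  have hone : ∏ᶠ m, χ (l.1 m) ^ n = 1 := by
    have h0 : ∑ᶠ k, l.1 k = 0 := l.2
    have h1 : (χ.toMonoidHom (Multiplicative.ofAdd (∑ᶠ k, l.1 k))) = ∏ᶠ k, χ (l.1 k) := by
      rw [finsum_eq_sum_of_support_subset (s := l.1.support) _ (by simp),
        finprod_eq_prod_of_mulSupport_subset (s := l.1.support)]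
      · exact map_prod χ.toMonoidHom (fun k => Multiplicative.ofAdd (l.1 k)) l.1.support
      · intro k hk
        contrapose! hk
        have : l.1 k = 0 := by simpa using hk
        simp [this]
    have h2 := hfin l.1 (fun _ => 1)
    simp only [zpow_one] at h2
    have h3 := MonoidHom.map_finprod (zpowGroupHom n) h2
    rw [← h1, h0] at h3
    simpa using h3.symm
  have h3 : wt χ p (act q l) = ∏ᶠ m, χ (l.1 m) ^ det2 p.left.toAdd (p.right.1.mulVec (q • m)) := by
    rw [wt_eq]
    have h := finprod_comp_equiv
      (f := fun m => χ ((act q l).1 m) ^ det2 p.left.toAdd (p.right.1.mulVec m))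
      (MulAction.toPerm q)
    refine h.symm.trans (finprod_congr fun m => ?_)
    rw [act_apply, MulAction.toPerm_apply, inv_smul_smul]
  rw [h3, ← mul_one (wt χ (p * q) l), ← hone, wt_eq, wt_eq,
    ← finprod_mul_distrib (hfin _ _) (hfin _ _), ← finprod_mul_distrib (hfin _ _) (hfin _ _)]
  refine finprod_congr fun m => ?_
  rw [← zpow_add, ← zpow_add]
  congr 1
  have h4 : (p * q).left.toAdd = p.left.toAdd + p.right.1.mulVec q.left.toAdd := rfl
  have h5 : (p * q).right.1.mulVec m = p.right.1.mulVec (q.right.1.mulVec m) := by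
    rw [Matrix.mulVec_mulVec]
    rfl
  rw [h4, h5, gam_smul_def, Matrix.mulVec_add, det2_add_left, det2_add_right, det2_mulVec, hn]
  ring

/-- The unitary of `ℓ²(Λ(H))` implementing `β(p)`, with `δ_λ ↦ wt(p, λ) δ_{p · λ}`. -/
def W (χ : AddChar H Circle) : Gam →* unitary (L2 (Lam H) →L[ℂ] L2 (Lam H)) where
  toFun p := monomial (act p).toEquiv (wt χ p)
  map_one' := by
    refine monomial_ext fun f x => ?_
    have h1 : ∀ l : Lam H, wt χ 1 l = 1 := fun l => by simp [wt_eq, det2]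
    have h2 : (act (1 : Gam)).toEquiv.symm x = x := by
      rw [Equiv.symm_apply_eq]
      ext k
      exact (by simp [act_apply] : x.1 k = (act (1 : Gam) x).1 k)
    rw [monomial_apply, h1, h2]
    simp
  map_mul' p q := by
    rw [monomial_mul]
    have h1 : (act (p * q)).toEquiv = (act p).toEquiv * ((act q).toEquiv : Equiv.Perm (Lam H)) := by
      ext l k
      change (act (p * q) l).1 k = (act p (act q l)).1 k
      simp only [act_apply, mul_inv_rev, mul_smul]
    rw [h1]
    congr 1
    funext l
    exact wt_mul χ p q l

/-- Conjugation by the unitaries `W`. -/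
def conjW (χ : AddChar H Circle) :
    Gam →* ((L2 (Lam H) →L[ℂ] L2 (Lam H)) ≃⋆ₐ[ℂ] (L2 (Lam H) →L[ℂ] L2 (Lam H))) :=
  (Unitary.conjStarAlgAut ℂ (L2 (Lam H) →L[ℂ] L2 (Lam H))).comp (W χ)

lemma conjW_mem (μ : Cocycle H) (χ : AddChar H Circle) (p : Gam) (x : N μ) :
    conjW χ p x ∈ (groupVN (tildeLam μ)).toStarSubalgebra :=
  conj_mem _ (act p) (tildeLam_act μ p) (wt χ p) x.2

lemma conjW_mul (χ : AddChar H Circle) (p q : Gam) (x : L2 (Lam H) →L[ℂ] L2 (Lam H)) :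
    conjW χ (p * q) x = conjW χ p (conjW χ q x) :=
  DFunLike.congr_fun ((conjW χ).map_mul p q) x

lemma conjW_one (χ : AddChar H Circle) (x : L2 (Lam H) →L[ℂ] L2 (Lam H)) :
    conjW χ 1 x = x :=
  DFunLike.congr_fun (conjW χ).map_one x

lemma conjW_inv (χ : AddChar H Circle) (p : Gam) (x : L2 (Lam H) →L[ℂ] L2 (Lam H)) :
    conjW χ p⁻¹ (conjW χ p x) = x := by
  rw [← conjW_mul, inv_mul_cancel, conjW_one]

lemma conjW_inv' (χ : AddChar H Circle) (p : Gam) (x : L2 (Lam H) →L[ℂ] L2 (Lam H)) :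
    conjW χ p (conjW χ p⁻¹ x) = x := by
  rw [← conjW_mul, mul_inv_cancel, conjW_one]

/-- The automorphism `β(p)` of `N(H, μ)`, for `p` in `ℤ² ⋊ SL(2, ℤ)`. -/
def betaAut (μ : Cocycle H) (χ : AddChar H Circle) (p : Gam) : AutVN (tildeLam μ) where
  toFun x := ⟨conjW χ p x, conjW_mem μ χ p x⟩
  invFun x := ⟨conjW χ p⁻¹ x, conjW_mem μ χ p⁻¹ x⟩
  left_inv x := Subtype.ext (conjW_inv χ p x.1)
  right_inv x := Subtype.ext (conjW_inv' χ p x.1)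
  map_mul' x y := Subtype.ext (map_mul (conjW χ p) x.1 y.1)
  map_add' x y := Subtype.ext (map_add (conjW χ p) x.1 y.1)
  map_star' x := Subtype.ext (map_star (conjW χ p) x.1)
  map_smul' c x := Subtype.ext (map_smul (conjW χ p) c x.1)

/-- The twisted Bernoulli shift action `β(H, μ, χ)` of `ℤ² ⋊ SL(2, ℤ)` on `N(H, μ)`; it is
implemented by the unitaries `W`, and `beta_U` is its defining formula. -/
def beta (μ : Cocycle H) (χ : AddChar H Circle) : Gam →* AutVN (tildeLam μ) where
  toFun := betaAut μ χ
  map_one' := StarAlgEquiv.ext fun x => Subtype.ext (conjW_one χ x)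
  map_mul' p q := StarAlgEquiv.ext fun x => Subtype.ext (conjW_mul χ p q x)

/-- `β(k, γ)(u(λ)) = (∏_m χ((γ · λ)(m)) ^ det(k, m)) u(k · γ · λ)`. -/
lemma beta_U (μ : Cocycle H) (χ : AddChar H Circle) (p : Gam) (l : Lam H) :
    beta μ χ p (U (tildeLam μ) l) = (wt χ p l : ℂ) • U (tildeLam μ) (act p l) := by
  refine Subtype.ext ?_
  change (monomial (act p).toEquiv (wt χ p) : L2 (Lam H) →L[ℂ] L2 (Lam H)) * u (tildeLam μ) l *
    star (monomial (act p).toEquiv (wt χ p) : L2 (Lam H) →L[ℂ] L2 (Lam H)) =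
    (wt χ p l : ℂ) • (u (tildeLam μ) (act p l) : L2 (Lam H) →L[ℂ] L2 (Lam H))
  rw [monomial_conj_u _ _ (tildeLam_act μ p) _ l, smul_mul_assoc, mul_assoc]
  simp

/-- The group `Aut(A, β)` of all `*`-automorphisms of `A` commuting with an action `β`. -/
def commAut {A Γ : Type*} [Ring A] [StarRing A] [Algebra ℂ A] [Group Γ]
    (β : Γ →* (A ≃⋆ₐ[ℂ] A)) : Subgroup (A ≃⋆ₐ[ℂ] A) where
  carrier := {α | ∀ p x, β p (α x) = α (β p x)}
  one_mem' _ _ := rfl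
  mul_mem' {a b} ha hb p x := (ha p (b x)).trans (congrArg a (hb p x))
  inv_mem' {a} ha p x := by
    refine EquivLike.injective a ?_
    have h : ∀ y, a (a⁻¹ y) = y := fun y => a.apply_symm_apply y
    have h' : ∀ y, β p (a y) = a (β p y) := ha p
    rw [h, ← h', h]

/-- The group `Aut(N(H, μ), β(H, μ, χ))`, with the topology of pointwise convergence in `2`-norm
(as a subspace of `AutVN`). -/
abbrev Centralizer (μ : Cocycle H) (χ : AddChar H Circle) : Subgroup (AutVN (tildeLam μ)) :=
  commAut (beta μ χ)

/-- The image `φ ∘ λ` of `λ ∈ Λ(H)` under an automorphism `φ` of `H`. -/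
def mapLam (φ : H ≃+ H) (l : Lam H) : Lam H :=
  ⟨l.1.mapRange φ (map_zero φ), by
    have h : ∑ᶠ k, l.1 k = 0 := l.2
    change ∑ᶠ k, φ (l.1 k) = 0
    rw [← AddEquiv.map_finsum, h, map_zero]⟩

end

/-! ### Automorphisms of `H` -/

/-- The group `Aut(H, b, χ)` of automorphisms of `H` preserving a function `b : H × H → 𝕋` and a
character `χ`. -/
structure AutH {H : Type*} [AddCommGroup H] (b : H → H → Circle) (χ : AddChar H Circle) where
  toAddEquiv : H ≃+ H
  map_b : ∀ g h, b (toAddEquiv g) (toAddEquiv h) = b g h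
  map_χ : ∀ g, χ (toAddEquiv g) = χ g

section

variable {H : Type*} [AddCommGroup H] {b : H → H → Circle} {χ : AddChar H Circle}

lemma AutH.ext' {φ ψ : AutH b χ} (h : ∀ g, φ.toAddEquiv g = ψ.toAddEquiv g) : φ = ψ := by
  cases φ
  cases ψ
  congr
  ext g
  exact h g

/-- The group structure is composition. -/
instance : Group (AutH b χ) where
  mul φ ψ := ⟨ψ.toAddEquiv.trans φ.toAddEquiv, fun g h => by simp [φ.map_b, ψ.map_b],
    fun g => by simp [φ.map_χ, ψ.map_χ]⟩
  one := ⟨AddEquiv.refl H, fun _ _ => rfl, fun _ => rfl⟩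
  inv φ := ⟨φ.toAddEquiv.symm, fun g h => by
      simpa using (φ.map_b (φ.toAddEquiv.symm g) (φ.toAddEquiv.symm h)).symm, fun g => by
      simpa using (φ.map_χ (φ.toAddEquiv.symm g)).symm⟩
  mul_assoc _ _ _ := rfl
  one_mul _ := rfl
  mul_one _ := rfl
  inv_mul_cancel φ := AutH.ext' fun g => φ.toAddEquiv.symm_apply_apply g

/-- The topology of pointwise convergence: the coarsest one for which every evaluation `φ ↦ φ(g)`
is continuous for the discrete topology of `H`. -/
instance : TopologicalSpace (AutH b χ) :=
  ⨅ g : H, TopologicalSpace.induced (fun φ : AutH b χ => φ.toAddEquiv g) ⊥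

end

end TwistedBernoulli

end

/-!
# Centralizers of twisted Bernoulli actions

An element `x` of `L_μ(G)` is recorded by its coefficients, the vector `x δ_0` of `ℓ²(G)`; right
translations commute with `L_μ(G)`, so this vector determines `x` (`LVN_ext`), and the support of
the coefficients of `x y` is controlled by the supports for `x` and `y` (`mul_coeff_ne_zero`).

**From automorphisms of `N(H, μ)` to automorphisms of `H`.** Let `π` commute with `β`. The group
`Λ(H)` is generated by the edges `h δ_a - h δ_b`. The shears of `ℤ²` that fix the line through `a`
and `b` fix the edge, so they leave the coefficients of `π(u(h δ_a - h δ_b))` invariant up to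
phases; these coefficients are square summable, hence vanish at every `λ` with an infinite orbit,
and the coefficients live on functions `λ` carried by the line (`support_of_shear`). The three
edges of the triangle `0, (1, 0), (0, 1)` satisfy, up to a scalar, `u(edge₁) u(edge₂) = u(edge₃)`,
and comparing the supports on the three lines leaves a single coefficient, at
`φ(h) δ_a - φ(h) δ_b` (`exists_edge_of_triangle`). Thus `π(u(λ)) = z u(φ ∘ λ)`
(`exists_implements`). The commutation relations between edges with a common vertex give the
invariance of `μ*μ` (`Implements.starMul`). Propagating the scalar of one edge around two triangles
of opposite orientation computes this scalar in two ways: the comparison gives the invariance of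
`χ²` (`Implements.char_sq`), and either of them expresses the scalar through `μ`, `χ` and `φ`
(`phase_eq`).

**Rigidity.** Consequently `φ` determines `π` on every `u(λ)`, and then `π` itself
(`aut_ext_U`). Normality of `π` is not assumed; `aut_apply_eq_self` uses instead that `π` is
isometric for the operator norm, together with a regularizing operator in `L_μ(G)`
(`exists_regularization`).

**Converse.** Given `φ` in `Aut(H, μ*μ, χ²)`, the cocycle `μ(φ(g), φ(h)) / μ(g, h)` is symmetric,
hence a coboundary because the circle is divisible (`exists_coboundary`), and `η = (χ ∘ φ) / χ` has
values `±1`. A monomial unitary with phases built from a trivialization of the coboundary, and from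
`η` raised to a quadratic function of `m ∈ ℤ²` whose polarization modulo `2` is the determinant,
implements an automorphism that commutes with `β` (`exists_commutesBeta_implements`).

**Topologies.** By rigidity every `π` is one of these explicit automorphisms, so it preserves the
`2`-norm, and `π(u(λ))` depends on finitely many values of `φ` only. This gives the continuity of
the inverse map; the map itself is continuous because unimodular multiples of distinct `u(λ)` are at
`2`-norm distance at least `1`. The topological group structure of the centralizer is transported
from that of `Aut(H, μ*μ, χ²)`.
-/

noncomputable section

namespace TwistedBernoulli

/-! ### Fourier coefficients in twisted group von Neumann algebras -/

section Coefficients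

lemma delta_self {X : Type*} (x : X) : delta x x = 1 := by
  classical
  simp [delta]

lemma delta_of_ne {X : Type*} {x y : X} (h : y ≠ x) : delta x y = 0 := by
  classical
  simp [delta, h]

lemma inner_delta {X : Type*} (x : X) (f : L2 X) : inner ℂ (delta x) f = f x := by
  classical
  have := lp.inner_single_left (𝕜 := ℂ) (G := fun _ : X => ℂ) x 1 f
  rw [delta]
  convert this
  simp

lemma norm_delta {X : Type*} (x : X) : ‖delta x‖ = 1 := by
  classical
  rw [delta, lp.norm_single (by simp)]
  simp

lemma eq_smul_delta {X : Type*} {f : L2 X} {x : X} (h : ∀ y, f y ≠ 0 → y = x) :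
    f = f x • delta x := by
  ext y
  change f y = f x * delta x y
  by_cases hy : y = x
  · rw [hy, delta_self, mul_one]
  · rw [delta_of_ne hy, mul_zero]
    by_contra h'
    exact hy (h y h')

lemma hasSum_delta {X : Type*} (f : L2 X) : HasSum (fun x => f x • delta x) f := by
  classical
  have h := lp.hasSum_single (E := fun _ : X => ℂ) (p := 2) (by simp) f
  convert h using 2 with x
  rw [delta, ← lp.single_smul]
  simp

/-- Bounded operators on `ℓ²(X)` are determined by their values on the basis vectors. -/
lemma ext_delta {X : Type*} {a b : L2 X →L[ℂ] L2 X} (h : ∀ x, a (delta x) = b (delta x)) :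
    a = b := by
  ext1 f
  have ha := (hasSum_delta f).mapL a
  have hb := (hasSum_delta f).mapL b
  simp only [map_smul, h] at ha hb
  exact ha.unique hb

lemma monomial_delta {X : Type*} (e : Equiv.Perm X) (w : X → Circle) (x : X) :
    (monomial e w : L2 X →L[ℂ] L2 X) (delta x) = (w x : ℂ) • delta (e x) := by
  ext y
  rw [monomial_apply]
  change _ = (w x : ℂ) * delta (e x) y
  by_cases hy : y = e x
  · subst hy
    simp [delta_self]
  · rw [delta_of_ne hy, delta_of_ne, mul_zero, mul_zero]
    rintro rfl
    simp at hy

variable {G : Type*} [AddCommGroup G] (μ : Cocycle G)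

lemma u_delta (g h : G) :
    (u μ g : L2 G →L[ℂ] L2 G) (delta h) = (μ g h : ℂ) • delta (g + h) :=
  monomial_delta _ _ _

lemma U_delta_zero (g : G) : (U μ g).1 (delta 0) = delta g := by
  change (u μ g : L2 G →L[ℂ] L2 G) (delta 0) = _
  rw [u_delta, μ.zero_right']
  simp

lemma U_mul (g h : G) : U μ g * U μ h = (μ g h : ℂ) • U μ (g + h) := by
  refine Subtype.ext (ext_delta fun x => ?_)
  change (u μ g : L2 G →L[ℂ] L2 G) ((u μ h : L2 G →L[ℂ] L2 G) (delta x)) =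
    (μ g h : ℂ) • (u μ (g + h) : L2 G →L[ℂ] L2 G) (delta x)
  rw [u_delta, map_smul, u_delta, u_delta, smul_smul, smul_smul, add_assoc, ← Circle.coe_mul,
    ← Circle.coe_mul, μ.cocycle', mul_comm]

lemma U_zero : U μ 0 = 1 := by
  refine Subtype.ext (ext_delta fun x => ?_)
  change (u μ 0 : L2 G →L[ℂ] L2 G) (delta x) = delta x
  rw [u_delta, μ.zero_left']
  simp

/-- The unitary `δ_s ↦ μ(s, t) δ_{s + t}`, which commutes with `L_μ(G)`. -/
def rightMul (t : G) : unitary (L2 G →L[ℂ] L2 G) :=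
  monomial (Equiv.addRight t) (fun s => μ s t)

lemma rightMul_comm_u (g t : G) : rightMul μ t * u μ g = u μ g * rightMul μ t := by
  rw [rightMul, u, monomial_mul, monomial_mul]
  congr 1
  · ext s
    simp [add_assoc]
  · funext s
    have := μ.cocycle' g s t
    simp only [Equiv.coe_addLeft, Equiv.coe_addRight]
    rw [mul_comm, this, mul_comm]

/-- The commutant of the unitaries `u(g)` commutes with `L_μ(G)`. -/
lemma comm_of_forall_u (x : LVN μ) {v : unitary (L2 G →L[ℂ] L2 G)}
    (hv : ∀ g, v * u μ g = u μ g * v) :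
    (v : L2 G →L[ℂ] L2 G) * x.1 = x.1 * v := by
  refine mem_groupVN.1 x.2 _ fun g => ⟨?_, ?_⟩
  · exact congrArg Subtype.val (hv g).symm
  · have h : star (u μ g) * v = v * star (u μ g) := by
      rw [Unitary.star_eq_inv, inv_mul_eq_iff_eq_mul, ← mul_assoc, ← hv, mul_inv_cancel_right]
    exact congrArg Subtype.val h

lemma rightMul_comm (x : LVN μ) (t : G) :
    (rightMul μ t : L2 G →L[ℂ] L2 G) * x.1 = x.1 * rightMul μ t :=
  comm_of_forall_u μ x fun g => rightMul_comm_u μ g t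

lemma apply_delta (x : LVN μ) (t : G) :
    x.1 (delta t) = (rightMul μ t : L2 G →L[ℂ] L2 G) (x.1 (delta 0)) := by
  have h := DFunLike.congr_fun (rightMul_comm μ x t) (delta 0)
  have h2 : (rightMul μ t : L2 G →L[ℂ] L2 G) (delta 0) = delta t := by
    rw [rightMul, monomial_delta, μ.zero_left']
    simp
  change (rightMul μ t : L2 G →L[ℂ] L2 G) (x.1 (delta 0)) =
    x.1 ((rightMul μ t : L2 G →L[ℂ] L2 G) (delta 0)) at h
  rw [h, h2]

lemma apply_delta_apply (x : LVN μ) (t s : G) :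
    x.1 (delta t) s = μ (s - t) t * x.1 (delta 0) (s - t) := by
  rw [apply_delta, rightMul, monomial_apply]
  simp [sub_eq_add_neg]

/-- The vector `δ_0` is separating for `L_μ(G)`. -/
lemma LVN_ext {x y : LVN μ} (h : x.1 (delta 0) = y.1 (delta 0)) : x = y :=
  Subtype.ext (ext_delta fun t => by
    rw [apply_delta μ x, h, ← apply_delta μ y])

/-- Since the functional `tr` is tracial, `‖x*‖₂ = ‖x‖₂`. -/
lemma norm_star_delta (x : LVN μ) : ‖(star x).1 (delta 0)‖ = ‖x.1 (delta 0)‖ := by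
  have key : ∀ s, ‖(star x).1 (delta 0) s‖ = ‖x.1 (delta 0) (-s)‖ := by
    intro s
    have h1 : (star x).1 (delta 0) s = (starRingEnd ℂ) (x.1 (delta s) 0) := by
      rw [← inner_delta, ← inner_delta, inner_conj_symm]
      change inner ℂ (delta s) ((star x.1) (delta 0)) = _
      rw [ContinuousLinearMap.star_eq_adjoint, ContinuousLinearMap.adjoint_inner_right]
    rw [h1, apply_delta_apply, RCLike.norm_conj, norm_mul, Circle.norm_coe, one_mul, zero_sub]
  rw [lp.norm_eq_tsum_rpow (by simp), lp.norm_eq_tsum_rpow (by simp)]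
  congr 1
  simp only [key]
  exact (Equiv.neg G).tsum_eq (fun i => ‖x.1 (delta 0) i‖ ^ _)

lemma hasSum_mul_delta (x y : LVN μ) (r : G) :
    HasSum (fun t => y.1 (delta 0) t * (μ (r - t) t * x.1 (delta 0) (r - t)))
      ((x * y).1 (delta 0) r) := by
  have h := ((hasSum_delta (y.1 (delta 0))).mapL x.1).mapL
    (lp.evalCLM (𝕜 := ℂ) (p := 2) (E := fun _ : G => ℂ) r)
  simp only [map_smul] at h
  simp only [← apply_delta_apply]
  exact h

/-- If `r = s + t` is the only decomposition of `r` along the supports of the coefficients of `x`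
and of `y`, then `r` is in the support of the coefficients of `x * y`. -/
lemma mul_coeff_ne_zero {x y : LVN μ} {s t : G} (hs : x.1 (delta 0) s ≠ 0)
    (ht : y.1 (delta 0) t ≠ 0)
    (huniq : ∀ s' t', x.1 (delta 0) s' ≠ 0 → y.1 (delta 0) t' ≠ 0 → s' + t' = s + t → t' = t) :
    (x * y).1 (delta 0) (s + t) ≠ 0 := by
  have h1 := hasSum_mul_delta μ x y (s + t)
  have h2 := _root_.hasSum_single (f := fun t' => y.1 (delta 0) t' *
      (μ (s + t - t') t' * x.1 (delta 0) (s + t - t'))) t (by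
    intro t' ht'
    by_contra h
    have ha := left_ne_zero_of_mul h
    have hb := right_ne_zero_of_mul (right_ne_zero_of_mul h)
    exact ht' (huniq _ _ hb ha (sub_add_cancel _ _)))
  rw [h1.unique h2, add_sub_cancel_right]
  exact mul_ne_zero ht (mul_ne_zero (Circle.coe_ne_zero _) hs)

lemma U_smul_inj {c c' : Circle} {g g' : G} (h : (c : ℂ) • U μ g = (c' : ℂ) • U μ g') :
    g = g' ∧ c = c' := by
  have h1 : (c : ℂ) • delta g = (c' : ℂ) • delta g' := by
    rw [← U_delta_zero μ g, ← U_delta_zero μ g']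
    exact congrArg (fun x : LVN μ => x.1 (delta 0)) h
  have h2 : (c : ℂ) * delta g g = c' * delta g' g := congrArg (fun f : L2 G => f g) h1
  rw [delta_self, mul_one] at h2
  by_cases hg : g = g'
  · subst hg
    rw [delta_self, mul_one] at h2
    exact ⟨rfl, Circle.ext h2⟩
  · rw [delta_of_ne hg, mul_zero] at h2
    exact absurd h2 (Circle.coe_ne_zero _)

end Coefficients

/-! ### Automorphisms are determined by the unitaries `u(g)` -/

section Regularization

variable {E : Type*} [NormedAddCommGroup E] [InnerProductSpace ℂ E]

/-- The image of a square-summable sequence under a bounded operator. -/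
def mapL2 (z : E →L[ℂ] E) (f : lp (fun _ : ℕ => E) 2) : lp (fun _ : ℕ => E) 2 :=
  ⟨fun n => z (f n), by
    have h := (memℓp_gen_iff (p := 2) (by simp)).1 (lp.memℓp f)
    refine (memℓp_gen_iff (p := 2) (by simp)).2 ?_
    refine Summable.of_nonneg_of_le (fun n => by positivity) (fun n => ?_)
      (h.mul_left (‖z‖ ^ (2 : ENNReal).toReal))
    rw [← Real.mul_rpow (norm_nonneg _) (norm_nonneg _)]
    exact Real.rpow_le_rpow (norm_nonneg _) (z.le_opNorm _) (by simp)⟩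

/-- For operators `A n` with `A 0 = 1`, the square-summable sequences `(A n ξ)_n`: the graph of the
closed operator `ξ ↦ (A n ξ)_n` with values in `ℓ²`. -/
def graphL2 (A : ℕ → E →L[ℂ] E) : Submodule ℂ (lp (fun _ : ℕ => E) 2) where
  carrier := {f | ∀ n, f n = A n (f 0)}
  zero_mem' n := by simp
  add_mem' {f g} hf hg n := by
    change f n + g n = A n (f 0 + g 0)
    rw [map_add, ← hf n, ← hg n]
  smul_mem' c f hf n := by
    change c • f n = A n (c • f 0)
    rw [map_smul, ← hf n]

lemma mem_graphL2 {A : ℕ → E →L[ℂ] E} {f : lp (fun _ : ℕ => E) 2} :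
    f ∈ graphL2 A ↔ ∀ n, f n = A n (f 0) := Iff.rfl

lemma isClosed_graphL2 (A : ℕ → E →L[ℂ] E) :
    IsClosed (graphL2 A : Set (lp (fun _ : ℕ => E) 2)) := by
  have h : (graphL2 A : Set (lp (fun _ : ℕ => E) 2)) = ⋂ n, {f | f n = A n (f 0)} := by
    ext f
    simp [mem_graphL2]
  rw [h]
  refine isClosed_iInter fun n => isClosed_eq ?_ ?_
  · exact (lp.evalCLM (𝕜 := ℂ) (p := 2) (E := fun _ : ℕ => E) n).continuous
  · exact (A n).continuous.comp (lp.evalCLM (𝕜 := ℂ) (p := 2) (E := fun _ : ℕ => E) 0).continuous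

variable [CompleteSpace E]

/-- If `∑ ‖A n η‖² < ∞` on a total set of vectors `η`, then some injective bounded operator `b`
makes all the `A n * b` contractive, and `b` may be taken in the von Neumann algebra generated by
the `A n`. Morally `b = (1 + ∑ A n* A n)⁻¹`; it is constructed as `J J*`, where `J` is the
first coordinate on the graph of `ξ ↦ (A n ξ)_n`. -/
lemma exists_regularization (A : ℕ → E →L[ℂ] E) (hA : A 0 = 1) (D : Set E)
    (hD : ∀ ξ, (∀ η ∈ D, inner ℂ η ξ = 0) → ξ = 0)
    (hsum : ∀ η ∈ D, Memℓp (fun n => A n η) 2) :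
    ∃ b : E →L[ℂ] E, IsSelfAdjoint b ∧ Function.Injective b ∧ (∀ n, ‖A n * b‖ ≤ 1) ∧
      ∀ z : E →L[ℂ] E, (∀ n, z * A n = A n * z) → (∀ n, star z * A n = A n * star z) →
        z * b = b * z := by
  have : CompleteSpace (graphL2 A) := (isClosed_graphL2 A).completeSpace_coe
  let J : graphL2 A →L[ℂ] E :=
    (lp.evalCLM (𝕜 := ℂ) (p := 2) (E := fun _ : ℕ => E) 0).comp (graphL2 A).subtypeL
  have hJ : ∀ f : graphL2 A, J f = f.1 0 := fun _ => rfl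
  have hJnorm : ‖J‖ ≤ 1 := by
    refine J.opNorm_le_bound zero_le_one fun f => ?_
    rw [one_mul]
    exact lp.norm_apply_le_norm (by simp) f.1 0
  have hJadj : ‖ContinuousLinearMap.adjoint J‖ ≤ 1 := by
    rwa [LinearIsometryEquiv.norm_map]
  refine ⟨J ∘L ContinuousLinearMap.adjoint J, ?_, ?_, ?_, ?_⟩
  · rw [ContinuousLinearMap.isSelfAdjoint_iff', ContinuousLinearMap.adjoint_comp,
      ContinuousLinearMap.adjoint_adjoint]
  · refine (injective_iff_map_eq_zero _).2 fun ξ hξ => hD ξ fun η hη => ?_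
    have h1 : ContinuousLinearMap.adjoint J ξ = 0 := by
      rw [← inner_self_eq_zero (𝕜 := ℂ), ContinuousLinearMap.adjoint_inner_left]
      change inner ℂ ξ ((J ∘L ContinuousLinearMap.adjoint J) ξ) = 0
      rw [hξ, inner_zero_right]
    have h2 : (⟨fun n => A n η, hsum η hη⟩ : lp (fun _ : ℕ => E) 2) ∈ graphL2 A := by
      intro n
      change A n η = A n (A 0 η)
      rw [hA]
      rfl
    have h3 : J ⟨_, h2⟩ = η := by
      change A 0 η = η
      rw [hA]
      rfl
    rw [← h3, ← ContinuousLinearMap.adjoint_inner_right, h1, inner_zero_right]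
  · intro n
    refine ContinuousLinearMap.opNorm_le_bound _ zero_le_one fun ξ => ?_
    set g := ContinuousLinearMap.adjoint J ξ with hg
    change ‖A n (g.1 0)‖ ≤ 1 * ‖ξ‖
    rw [← mem_graphL2.1 g.2 n]
    refine (lp.norm_apply_le_norm (by simp) g.1 n).trans ?_
    exact (ContinuousLinearMap.adjoint J).le_of_opNorm_le hJadj ξ
  · intro z hz hz'
    have hmem : ∀ w : E →L[ℂ] E, (∀ n, w * A n = A n * w) → ∀ f : graphL2 A,
        mapL2 w f.1 ∈ graphL2 A := by
      intro w hw f n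
      change w (f.1 n) = A n (w (f.1 0))
      rw [mem_graphL2.1 f.2 n]
      exact DFunLike.congr_fun (hw n) (f.1 0)
    have hadj : ∀ ξ, ContinuousLinearMap.adjoint J (z ξ) =
        ⟨mapL2 z (ContinuousLinearMap.adjoint J ξ).1, hmem z hz _⟩ := by
      intro ξ
      refine ext_inner_left ℂ fun f => ?_
      rw [ContinuousLinearMap.adjoint_inner_right]
      have h1 : inner ℂ (J f) (z ξ) = inner ℂ (J ⟨mapL2 (star z) f.1, hmem _ hz' f⟩) ξ := by
        rw [← ContinuousLinearMap.adjoint_inner_left, ← ContinuousLinearMap.star_eq_adjoint]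
        rfl
      rw [h1, ← ContinuousLinearMap.adjoint_inner_right]
      change inner ℂ (mapL2 (star z) f.1) (ContinuousLinearMap.adjoint J ξ).1 =
        inner ℂ f.1 (mapL2 z (ContinuousLinearMap.adjoint J ξ).1)
      rw [lp.inner_eq_tsum, lp.inner_eq_tsum]
      refine tsum_congr fun n => ?_
      change inner ℂ (star z (f.1 n)) _ = inner ℂ (f.1 n) (z _)
      rw [ContinuousLinearMap.star_eq_adjoint, ContinuousLinearMap.adjoint_inner_left]
    ext1 ξ
    change z (J (ContinuousLinearMap.adjoint J ξ)) = J (ContinuousLinearMap.adjoint J (z ξ))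
    rw [hadj]
    rfl

end Regularization

section Rigidity

variable {G : Type*} [AddCommGroup G] {μ : Cocycle G}

lemma isClosed_groupVN (μ : Cocycle G) :
    IsClosed ((groupVN μ).toStarSubalgebra : Set (L2 G →L[ℂ] L2 G)) :=
  Set.isClosed_centralizer _

lemma norm_aut_apply (θ : AutVN μ) (x : LVN μ) : ‖(θ x).1‖ = ‖x.1‖ := by
  have := isClosed_groupVN μ
  exact NonUnitalStarAlgHom.norm_map θ (EquivLike.injective θ) x

/-- The coefficient expansion of `x` converges to `x` in `2`-norm. -/
lemma exists_finset_norm_sub_lt (x : LVN μ) {ε : ℝ} (hε : 0 < ε) :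
    ∃ s : Finset G, ‖(x - ∑ g ∈ s, x.1 (delta 0) g • U μ g).1 (delta 0)‖ < ε := by
  have h := (hasSum_delta (x.1 (delta 0))).eventually (Metric.ball_mem_nhds _ hε)
  obtain ⟨s, hs⟩ := h.exists
  refine ⟨s, ?_⟩
  rw [dist_comm, dist_eq_norm] at hs
  suffices h1 : (∑ g ∈ s, x.1 (delta 0) g • U μ g).1 (delta 0) =
      ∑ g ∈ s, x.1 (delta 0) g • delta g by
    change ‖x.1 (delta 0) - (∑ g ∈ s, x.1 (delta 0) g • U μ g).1 (delta 0)‖ < ε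
    rwa [h1]
  rw [AddSubmonoidClass.coe_finsetSum, sum_apply]
  refine Finset.sum_congr rfl fun g _ => ?_
  change x.1 (delta 0) g • (U μ g).1 (delta 0) = _
  rw [U_delta_zero]

/-- A `*`-automorphism of `L_μ(G)` that fixes the unitaries `u(g)` is the identity. No normality is
assumed: if `x n → x` in `2`-norm fast enough, with `x n` in the span of the `u(g)`, then there is
an injective `b` in `L_μ(G)` with `‖b (x - x n)‖ → 0`. Automorphisms are isometric for the operator
norm, so `θ(b) (θ(x) - x n) → 0`, whence `θ(b) (θ(x) - x) = 0`, and `b θ⁻¹(θ(x) - x) = 0`. -/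
lemma aut_apply_eq_self {θ : AutVN μ} (hθ : ∀ g, θ (U μ g) = U μ g) (x : LVN μ) : θ x = x := by
  choose s hs using fun n : ℕ => exists_finset_norm_sub_lt x
    (ε := (1 / 2) ^ n / (n + 1)) (by positivity)
  set a : ℕ → LVN μ := fun n => ∑ g ∈ s n, x.1 (delta 0) g • U μ g with ha
  have hθa : ∀ n, θ (a n) = a n := fun n => by simp only [ha, map_sum, map_smul, hθ]
  -- `A (n + 1) = (n + 1) (x - a n)*` is square-summable on each `δ_t` by the choice of `a`, and
  -- `‖A (n + 1) b‖ ≤ 1` says that `‖b (x - a n)‖ ≤ 1 / (n + 1)`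
  let A : ℕ → L2 G →L[ℂ] L2 G := fun n =>
    n.casesOn 1 fun n => ((n : ℂ) + 1) • (star (x - a n)).1
  have hA1 : ∀ n, A (n + 1) = ((n : ℂ) + 1) • (star (x - a n)).1 := fun _ => rfl
  have hcast : ∀ n : ℕ, ‖(n : ℂ) + 1‖ = n + 1 := fun n => by
    rw [← Nat.cast_succ, Complex.norm_natCast, Nat.cast_succ]
  obtain ⟨b, hbs, hbi, hbn, hbc⟩ := exists_regularization A rfl (Set.range delta)
    (fun ξ hξ => by
      ext t
      rw [← inner_delta t ξ, hξ _ ⟨t, rfl⟩]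
      rfl)
    (by
      rintro _ ⟨t, rfl⟩
      refine (memℓp_gen_iff (p := 2) (by simp)).2 ((summable_nat_add_iff 1).1 ?_)
      refine Summable.of_nonneg_of_le (fun n => by positivity) (fun n => ?_)
        (summable_geometric_of_lt_one (r := 1 / 4) (by norm_num) (by norm_num))
      have h1 : ‖A (n + 1) (delta t)‖ ≤ (1 / 2) ^ n := by
        change ‖((n : ℂ) + 1) • (star (x - a n)).1 (delta t)‖ ≤ _
        have h2 : ‖(star (x - a n)).1 (delta t)‖ = ‖(x - a n).1 (delta 0)‖ := by
          rw [apply_delta, ← norm_star_delta]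
          exact (Unitary.linearIsometryEquiv (rightMul μ t)).norm_map _
        rw [norm_smul, h2, hcast, ← le_div_iff₀' (by positivity)]
        exact (hs n).le
      have h2 : (ENNReal.toReal 2) = ((2 : ℕ) : ℝ) := by simp
      rw [h2, Real.rpow_natCast]
      calc _ ≤ ((1 / 2 : ℝ) ^ n) ^ 2 := by gcongr
        _ = (1 / 4) ^ n := by rw [← pow_mul, mul_comm, pow_mul]; norm_num)
  have hbmem : b ∈ (groupVN μ).toStarSubalgebra := by
    refine mem_groupVN.2 fun y hy => hbc y ?_ ?_
    · intro n
      cases n with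
      | zero => exact (mul_one y).trans (one_mul y).symm
      | succ n =>
        rw [hA1, mul_smul_comm, smul_mul_assoc, mem_groupVN.1 (star (x - a n)).2 y hy]
    · intro n
      cases n with
      | zero => exact (mul_one _).trans (one_mul _).symm
      | succ n =>
        have h := congrArg star (mem_groupVN.1 (x - a n).2 y hy)
        rw [star_mul, star_mul] at h
        rw [hA1, mul_smul_comm, smul_mul_assoc]
        congr 1
        exact h.symm
  let B : LVN μ := ⟨b, hbmem⟩
  have hB : ∀ n, ‖(θ B * (θ x - a n)).1‖ ≤ 1 / (n + 1) := by
    intro n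
    have h1 : θ B * (θ x - a n) = θ (B * (x - a n)) := by
      rw [map_mul, map_sub, hθa]
    have h2 := hbn (n + 1)
    rw [hA1, smul_mul_assoc, norm_smul, hcast, ← le_div_iff₀' (by positivity)] at h2
    rw [h1, norm_aut_apply]
    refine le_trans (le_of_eq ?_) h2
    rw [← norm_star]
    change ‖star (b * (x - a n).1)‖ = _
    rw [star_mul, hbs.star_eq]
    rfl
  have hlim : (θ B).1 ((θ x - x).1 (delta 0)) = 0 := by
    rw [← norm_le_zero_iff]
    have hlim1 : Filter.Tendsto (fun n : ℕ => (1 / ((n : ℝ) + 1)) + ‖(θ B).1‖ * (1 / 2) ^ n)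
        Filter.atTop (nhds 0) := by
      have h1 := tendsto_one_div_add_atTop_nhds_zero_nat (𝕜 := ℝ)
      have h2 := (tendsto_pow_atTop_nhds_zero_of_lt_one (r := (1 / 2 : ℝ)) (by norm_num)
        (by norm_num)).const_mul ‖(θ B).1‖
      simpa using h1.add h2
    refine ge_of_tendsto' hlim1 fun n => ?_
    have h1 : (θ x - x).1 (delta 0) = (θ x - a n).1 (delta 0) - (x - a n).1 (delta 0) := by
      change (θ x).1 (delta 0) - x.1 (delta 0) =
        ((θ x).1 (delta 0) - (a n).1 (delta 0)) - (x.1 (delta 0) - (a n).1 (delta 0))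
      abel
    rw [h1, map_sub]
    refine (norm_sub_le _ _).trans (add_le_add ?_ ?_)
    · have := (θ B * (θ x - a n)).1.le_of_opNorm_le (hB n) (delta 0)
      rwa [norm_delta, mul_one] at this
    · refine ((θ B).1.le_opNorm _).trans ?_
      refine mul_le_mul_of_nonneg_left ((hs n).le.trans ?_) (norm_nonneg _)
      exact div_le_self (by positivity) (by linarith [n.cast_nonneg (α := ℝ)])
  have hzero : θ B * (θ x - x) = 0 := LVN_ext μ hlim
  have hzero' : B * θ.symm (θ x - x) = 0 := by
    have h := congrArg θ.symm hzero
    rwa [map_mul, StarAlgEquiv.symm_apply_apply, map_zero] at h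
  have hz : θ.symm (θ x - x) = 0 := by
    refine LVN_ext μ (hbi ?_)
    have h := congrArg (fun y : LVN μ => y.1 (delta 0)) hzero'
    exact h.trans (map_zero b).symm
  have h := congrArg θ hz
  rw [StarAlgEquiv.apply_symm_apply, map_zero] at h
  exact sub_eq_zero.1 h

/-- `*`-automorphisms of `L_μ(G)` are determined by their values on the unitaries `u(g)`. -/
lemma aut_ext_U {α α' : AutVN μ} (h : ∀ g, α (U μ g) = α' (U μ g)) : α = α' := by
  refine StarAlgEquiv.ext fun x => ?_
  have h1 : (α.trans α'.symm) x = x := aut_apply_eq_self (fun g => by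
    change α'.symm (α (U μ g)) = U μ g
    rw [h, StarAlgEquiv.symm_apply_apply]) x
  have h2 := congrArg α' h1
  change α' (α'.symm (α x)) = α' x at h2
  rwa [StarAlgEquiv.apply_symm_apply] at h2

end Rigidity

/-! ### The elements `h δ_a - h δ_b` of `Λ(H)` -/

section Edges

variable {H : Type*} [AddCommGroup H]

/-- The basis vector `(1, 0)` of `ℤ²`. -/
def e₁ : Z2 := ![1, 0]

/-- The basis vector `(0, 1)` of `ℤ²`. -/
def e₂ : Z2 := ![0, 1]

/-- The element `h δ_a - h δ_b` of `Λ(H)`. -/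
def edge (h : H) (a b : Z2) : Lam H :=
  ⟨Finsupp.single a h - Finsupp.single b h, by
    change ∑ᶠ k, (Finsupp.single a h k - Finsupp.single b h k) = 0
    have key : ∀ c : Z2, ∑ᶠ k, Finsupp.single c h k = h := fun c => by
      rw [finsum_eq_single _ c fun k hk => Finsupp.single_eq_of_ne hk, Finsupp.single_eq_same]
    rw [finsum_sub_distrib (Finsupp.hasFiniteSupport _) (Finsupp.hasFiniteSupport _), key, key,
      sub_self]⟩

lemma Lam_ext {l l' : Lam H} (h : ∀ k, l.1 k = l'.1 k) : l = l' :=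
  Subtype.ext (Finsupp.ext h)

lemma edge_apply (h : H) (a b k : Z2) :
    (edge h a b).1 k = (if k = a then h else 0) - (if k = b then h else 0) := by
  change Finsupp.single a h k - Finsupp.single b h k = _
  rw [Finsupp.single_apply, Finsupp.single_apply]
  simp only [eq_comm]

lemma edge_add_edge (h : H) (a b c : Z2) : edge h a b + edge h b c = edge h a c := by
  refine Subtype.ext ?_
  change (Finsupp.single a h - Finsupp.single b h) + (Finsupp.single b h - Finsupp.single c h) =
    Finsupp.single a h - Finsupp.single c h
  abel

lemma edge_add (g h : H) (a b : Z2) : edge (g + h) a b = edge g a b + edge h a b := by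
  refine Subtype.ext ?_
  change Finsupp.single a (g + h) - Finsupp.single b (g + h) =
    (Finsupp.single a g - Finsupp.single b g) + (Finsupp.single a h - Finsupp.single b h)
  rw [Finsupp.single_add, Finsupp.single_add]
  abel

lemma edge_swap (h : H) (a b : Z2) : edge h a b = edge (-h) b a := by
  refine Subtype.ext ?_
  change Finsupp.single a h - Finsupp.single b h =
    Finsupp.single b (-h) - Finsupp.single a (-h)
  rw [Finsupp.single_neg, Finsupp.single_neg]
  abel

lemma edge_apply_left (h : H) {a b : Z2} (hab : a ≠ b) : (edge h a b).1 a = h := by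
  simp [edge_apply, hab]

lemma edge_injective {a b : Z2} (hab : a ≠ b) : Function.Injective fun h : H => edge h a b :=
  fun g h hgh => by
    rw [← edge_apply_left g hab, ← edge_apply_left h hab]
    exact congrArg (fun l : Lam H => l.1 a) hgh

lemma act_edge (p : Gam) (h : H) (a b : Z2) : act p (edge h a b) = edge h (p • a) (p • b) :=
  Lam_ext fun k => by
    rw [act_apply, edge_apply, edge_apply]
    simp only [inv_smul_eq_iff]

lemma mapLam_edge (φ : H ≃+ H) (h : H) (a b : Z2) : mapLam φ (edge h a b) = edge (φ h) a b :=
  Lam_ext fun k => by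
    change φ ((edge h a b).1 k) = _
    rw [edge_apply, edge_apply, map_sub]
    split_ifs <;> simp

lemma mapLam_apply (φ : H ≃+ H) (l : Lam H) (k : Z2) : (mapLam φ l).1 k = φ (l.1 k) := rfl

lemma mapLam_add (φ : H ≃+ H) (l l' : Lam H) : mapLam φ (l + l') = mapLam φ l + mapLam φ l' :=
  Lam_ext fun _ => map_add φ _ _

lemma mapLam_mapLam (φ φ' : H ≃+ H) (l : Lam H) :
    mapLam φ' (mapLam φ l) = mapLam (φ.trans φ') l :=
  Lam_ext fun _ => rfl

lemma mapLam_zero (φ : H ≃+ H) : mapLam φ 0 = 0 :=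
  Lam_ext fun _ => map_zero φ

lemma mapLam_act (φ : H ≃+ H) (p : Gam) (l : Lam H) :
    mapLam φ (act p l) = act p (mapLam φ l) :=
  Lam_ext fun _ => rfl

/-- An element of `Λ(H)` supported on two points is of the form `h δ_a - h δ_b`. -/
lemma eq_edge {l : Lam H} {a b : Z2} (hab : a ≠ b) (hl : ∀ k, k ≠ a → k ≠ b → l.1 k = 0) :
    l = edge (l.1 a) a b := by
  have h0 : ∑ᶠ k, l.1 k = 0 := l.2
  rw [finsum_eq_sum_of_support_subset (s := {a, b}), Finset.sum_pair hab] at h0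
  · refine Lam_ext fun k => ?_
    rw [edge_apply]
    by_cases ha : k = a
    · subst ha
      simp [hab]
    by_cases hb : k = b
    · subst hb
      simp [ha, eq_neg_of_add_eq_zero_right h0]
    · simp [ha, hb, hl k ha hb]
  · intro k hk
    by_contra h
    simp only [Finset.coe_insert, Finset.coe_singleton, Set.mem_insert_iff,
      Set.mem_singleton_iff, not_or] at h
    exact hk (hl k h.1 h.2)

lemma eq_zero_of_support {l : Lam H} {a : Z2} (hl : ∀ k, k ≠ a → l.1 k = 0) : l = 0 := by
  refine Lam_ext fun k => ?_
  have h0 : ∑ᶠ k, l.1 k = 0 := l.2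
  rw [finsum_eq_single _ a hl] at h0
  by_cases hk : k = a
  · rw [hk, h0]
    rfl
  · exact hl k hk

/-- The element `(k, A)` of `ℤ² ⋊ SL(2, ℤ)`, acting by `m ↦ k + A m`. -/
def transl (k : Z2) (A : SL(2, ℤ)) : Gam := ⟨Multiplicative.ofAdd k, A⟩

lemma transl_smul (k : Z2) (A : SL(2, ℤ)) (m : Z2) :
    transl k A • m = k + A.1.mulVec m := rfl

/-- The rotation of order `4` in `SL(2, ℤ)`. -/
def rot : SL(2, ℤ) := ⟨!![0, -1; 1, 0], by simp [Matrix.det_fin_two]⟩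

/-- The unipotent matrix taking `(1, 0)` to `(1, 1)`. -/
def unip : SL(2, ℤ) := ⟨!![1, 0; 1, 1], by simp [Matrix.det_fin_two]⟩

lemma rot_e₁ : rot.1.mulVec e₁ = e₂ := by
  ext i
  fin_cases i <;> simp [rot, e₁, e₂]

lemma unip_e₁ : unip.1.mulVec e₁ = e₁ + e₂ := by
  ext i
  fin_cases i <;> simp [unip, e₁, e₂]

lemma transl_zero_smul_e₁ (k : Z2) : transl k 1 • e₁ = k + e₁ := by
  rw [transl_smul]
  simp

lemma transl_rot_smul_e₁ (k : Z2) : transl k rot • e₁ = k + e₂ := by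
  rw [transl_smul, rot_e₁]

lemma transl_smul_zero (k : Z2) (A : SL(2, ℤ)) : transl k A • (0 : Z2) = k := by
  rw [transl_smul]
  simp

/-- As a group with an action of `ℤ² ⋊ SL(2, ℤ)`, `Λ(H)` is generated by the elements
`h δ_0 - h δ_{(1, 0)}`: every point of `ℤ²` is reached from `0` by a walk on
the grid. -/
lemma Lam_induction {P : Lam H → Prop} (hzero : P 0) (hadd : ∀ l l', P l → P l' → P (l + l'))
    (hedge : ∀ p h, P (act p (edge h 0 e₁))) (l : Lam H) : P l := by
  have h1 : ∀ h k, P (edge h k (k + e₁)) := fun h k => by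
    have := hedge (transl k 1) h
    rwa [act_edge, transl_smul_zero, transl_zero_smul_e₁] at this
  have h2 : ∀ h k, P (edge h k (k + e₂)) := fun h k => by
    have := hedge (transl k rot) h
    rwa [act_edge, transl_smul_zero, transl_rot_smul_e₁] at this
  have hsymm : ∀ a b, (∀ h, P (edge h a b)) → ∀ h, P (edge h b a) := fun a b hab h => by
    rw [edge_swap]
    exact hab _
  have htrans : ∀ a b c, (∀ h, P (edge h a b)) → (∀ h, P (edge h b c)) → ∀ h, P (edge h a c) :=
    fun a b c hab hbc h => by
      rw [← edge_add_edge h a b c]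
      exact hadd _ _ (hab h) (hbc h)
  have hx : ∀ (n : ℤ) (h : H), P (edge h 0 (n • e₁)) := by
    intro n
    induction n using Int.induction_on with
    | zero =>
      intro h
      rw [zero_smul]
      convert hzero using 1
      exact Lam_ext fun k => by rw [edge_apply, sub_self]; rfl
    | succ n ih =>
      refine htrans _ _ _ ih ?_
      rw [add_smul, one_smul]
      exact fun h => h1 h _
    | pred n ih =>
      refine htrans _ _ _ ih (hsymm _ _ fun h => ?_)
      have := h1 h ((-(n : ℤ) - 1) • e₁)
      rwa [show (-(n : ℤ) - 1) • e₁ + e₁ = -(n : ℤ) • e₁ by module] at this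
  have hy : ∀ (n m : ℤ) (h : H), P (edge h 0 (n • e₁ + m • e₂)) := by
    intro n m
    induction m using Int.induction_on with
    | zero =>
      rw [zero_smul, add_zero]
      exact hx n
    | succ m ih =>
      refine htrans _ _ _ ih ?_
      rw [add_smul, one_smul, ← add_assoc]
      exact fun h => h2 h _
    | pred m ih =>
      refine htrans _ _ _ ih (hsymm _ _ fun h => ?_)
      have := h2 h (n • e₁ + (-(m : ℤ) - 1) • e₂)
      rwa [show n • e₁ + (-(m : ℤ) - 1) • e₂ + e₂ = n • e₁ + -(m : ℤ) • e₂ by module] at this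
  have hall : ∀ (k : Z2) (h : H), P (edge h k 0) := by
    intro k
    have hk : k = k 0 • e₁ + k 1 • e₂ := by
      ext i
      fin_cases i <;> simp [e₁, e₂]
    rw [hk]
    exact hsymm _ _ (hy _ _)
  have hsum : l = ∑ k ∈ l.1.support, edge (l.1 k) k 0 := by
    refine Subtype.ext ?_
    rw [AddSubmonoidClass.coe_finsetSum]
    change l.1 = ∑ k ∈ l.1.support, (Finsupp.single k (l.1 k) - Finsupp.single 0 (l.1 k))
    have h0 : ∑ᶠ k, l.1 k = 0 := l.2
    rw [finsum_eq_sum_of_support_subset (s := l.1.support) _ (by simp)] at h0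
    have h1 := map_sum (Finsupp.singleAddHom (0 : Z2)) (fun k => l.1 k) l.1.support
    rw [h0, map_zero] at h1
    rw [Finset.sum_sub_distrib]
    refine Eq.trans ?_ (congrArg _ h1)
    rw [sub_zero]
    exact (Finsupp.sum_single l.1).symm
  rw [hsum]
  exact Finset.sum_induction _ P hadd hzero fun k _ => hall k _

end Edges

/-! ### Shears and supports of coefficients -/

section Shears

variable {H : Type*} [AddCommGroup H] {μ : Cocycle H} {χ : AddChar H Circle}

/-- The transvection `m ↦ m + n det(d, m) d` in `SL(2, ℤ)`. -/
def transvection (d : Z2) (n : ℤ) : SL(2, ℤ) :=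
  ⟨!![1 - n * d 0 * d 1, n * d 0 * d 0; -(n * d 1 * d 1), 1 + n * d 0 * d 1], by
    rw [Matrix.det_fin_two]
    simp
    ring⟩

/-- The affine shear `m ↦ m + n det(d, m - a) d`, which fixes the line `a + ℤ d` pointwise. -/
def shear (a d : Z2) (n : ℤ) : Gam :=
  transl (-(n * det2 d a) • d) (transvection d n)

lemma shear_smul (a d : Z2) (n : ℤ) (m : Z2) :
    shear a d n • m = m + (n * det2 d (m - a)) • d := by
  rw [shear, transl_smul]
  ext i
  fin_cases i <;> simp [transvection, dotProduct, Fin.sum_univ_two, det2] <;> ring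

lemma W_delta_zero (χ : AddChar H Circle) (p : Gam) :
    (W χ p : L2 (Lam H) →L[ℂ] L2 (Lam H)) (delta 0) = delta 0 := by
  change (monomial (act p).toEquiv (wt χ p) : L2 (Lam H) →L[ℂ] L2 (Lam H)) (delta 0) = delta 0
  rw [monomial_delta, AddChar.map_zero_eq_one]
  change ((1 : Circle) : ℂ) • delta (act p 0) = _
  rw [map_zero]
  simp

lemma beta_coeff (x : N μ) (p : Gam) (l : Lam H) :
    (beta μ χ p x).1 (delta 0) (act p l) = wt χ p l * x.1 (delta 0) l := by
  have h1 : star (W χ p : L2 (Lam H) →L[ℂ] L2 (Lam H)) (delta 0) = delta 0 := by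
    conv_lhs => rw [← W_delta_zero χ p]
    exact DFunLike.congr_fun (Unitary.coe_star_mul_self (W χ p)) (delta 0)
  change (W χ p : L2 (Lam H) →L[ℂ] L2 (Lam H)) (x.1 (star (W χ p :
    L2 (Lam H) →L[ℂ] L2 (Lam H)) (delta 0))) (act p l) = _
  rw [h1]
  change (wt χ p ((act p).toEquiv.symm (act p l)) : ℂ) *
    x.1 (delta 0) ((act p).toEquiv.symm (act p l)) = _
  rw [show (act p).toEquiv.symm (act p l) = l from (act p).symm_apply_apply l]

/-- If `x` is an eigenvector of all the shears fixing a line, its coefficients are supported on the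
elements of `Λ(H)` supported on that line: the other ones have infinite orbits, while the
coefficients are square-summable and of constant modulus on orbits. -/
lemma support_of_shear {x : N μ} {a d : Z2} (hd : d ≠ 0)
    (hx : ∀ n, ∃ c : Circle, beta μ χ (shear a d n) x = (c : ℂ) • x) {l : Lam H}
    (hl : x.1 (delta 0) l ≠ 0) {m : Z2} (hm : l.1 m ≠ 0) : det2 d (m - a) = 0 := by
  by_contra hdet
  set f := x.1 (delta 0) with hf
  have hconst : ∀ n, ‖f (act (shear a d n) l)‖ = ‖f l‖ := by
    intro n
    obtain ⟨c, hc⟩ := hx n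
    have h1 := beta_coeff (χ := χ) x (shear a d n) l
    rw [hc] at h1
    change (c : ℂ) * f (act (shear a d n) l) = _ * f l at h1
    calc ‖f (act (shear a d n) l)‖ = ‖(c : ℂ) * f (act (shear a d n) l)‖ := by
          rw [norm_mul, Circle.norm_coe, one_mul]
      _ = ‖f l‖ := by rw [h1, norm_mul, Circle.norm_coe, one_mul]
  have hfin : {l' | ‖f l‖ ≤ ‖f l'‖}.Finite := by
    have h1 := (memℓp_gen_iff (p := 2) (by simp)).1 (lp.memℓp f)
    have h2 := h1.tendsto_cofinite_zero.eventually_lt_const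
      (show 0 < ‖f l‖ ^ (2 : ENNReal).toReal from Real.rpow_pos_of_pos (norm_pos_iff.2 hl) _)
    refine h2.subset fun l' hl' => ?_
    simp only [Set.mem_compl_iff, Set.mem_ofPred_eq, not_lt]
    exact Real.rpow_le_rpow (norm_nonneg _) hl' (by simp)
  have hfin2 : (⋃ l' ∈ {l' | ‖f l‖ ≤ ‖f l'‖}, (l'.1.support : Set Z2)).Finite :=
    hfin.biUnion fun l' _ => l'.1.support.finite_toSet
  refine Set.infinite_range_of_injective (f := fun n : ℤ => shear a d n • m) ?_
    (hfin2.subset ?_)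
  · intro n n' hn
    simp only [shear_smul] at hn
    have h1 : (n * det2 d (m - a) - n' * det2 d (m - a)) • d = 0 := by
      rw [sub_smul, sub_eq_zero]
      exact add_left_cancel hn
    have h2 := (smul_eq_zero.1 h1).resolve_right hd
    rw [← sub_mul] at h2
    exact sub_eq_zero.1 ((mul_eq_zero.1 h2).resolve_right hdet)
  · rintro _ ⟨n, rfl⟩
    refine Set.mem_biUnion (x := act (shear a d n) l) (hconst n).ge ?_
    change shear a d n • m ∈ ((act (shear a d n) l).1.support : Set Z2)
    rw [Finset.mem_coe, Finsupp.mem_support_iff, act_apply, inv_smul_smul]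
    exact hm

/-- Let `x` and `y` have coefficients supported on two sides of a triangle of lines, and let the
coefficients of `x * y` be supported on the third side. Then `x` has a single nonzero coefficient,
at an element of `Λ(H)` supported on two vertices. -/
lemma exists_edge_of_triangle {x y : N μ} (hy : y ≠ 0)
    (hxs : ∀ l : Lam H, x.1 (delta 0) l ≠ 0 → ∀ m, l.1 m ≠ 0 → m 1 = 0)
    (hys : ∀ l : Lam H, y.1 (delta 0) l ≠ 0 → ∀ m, l.1 m ≠ 0 → m 0 + m 1 = 1)
    (hxy : ∀ l : Lam H, (x * y).1 (delta 0) l ≠ 0 → ∀ m, l.1 m ≠ 0 → m 0 = 0) :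
    ∃ g : H, ∀ l : Lam H, x.1 (delta 0) l ≠ 0 → l = edge g 0 e₁ := by
  have hex : ∀ {x : N μ}, x ≠ 0 → ∃ l, x.1 (delta 0) l ≠ 0 := by
    intro x hx
    by_contra! h
    exact hx (LVN_ext _ (lp.ext (funext h)))
  have he : ∀ m : Z2, m 1 = 0 → m 0 + m 1 = 1 → m = e₁ := by
    intro m h1 h2
    ext i
    fin_cases i
    · rw [h1, add_zero] at h2
      exact h2
    · exact h1
  have hsum : ∀ s t : Lam H, x.1 (delta 0) s ≠ 0 → y.1 (delta 0) t ≠ 0 →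
      ∀ m, s.1 m + t.1 m ≠ 0 → m 0 = 0 := by
    intro s t hs ht
    refine hxy (s + t) (mul_coeff_ne_zero _ hs ht fun s' t' hs' ht' h => ?_)
    -- `t' - t = s - s'` is carried by two lines that meet at `e₁` only, and its sum is `0`
    have h1 : t' - t = s - s' := by
      rw [sub_eq_sub_iff_add_eq_add, add_comm, h]
    rw [← sub_eq_zero]
    refine eq_zero_of_support (a := e₁) fun k hk => ?_
    by_contra hne
    refine hk (he k ?_ ?_)
    · rw [h1] at hne
      change s.1 k - s'.1 k ≠ 0 at hne
      by_contra h0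
      rw [not_imp_comm.1 (hxs s hs k) h0, not_imp_comm.1 (hxs s' hs' k) h0, sub_zero] at hne
      exact hne rfl
    · change t'.1 k - t.1 k ≠ 0 at hne
      by_contra h0
      rw [not_imp_comm.1 (hys t ht k) h0, not_imp_comm.1 (hys t' ht' k) h0, sub_zero] at hne
      exact hne rfl
  have h01 : (0 : Z2) ≠ e₁ := fun h => by simpa [e₁] using congrFun h 0
  have key : ∀ s t : Lam H, x.1 (delta 0) s ≠ 0 → y.1 (delta 0) t ≠ 0 →
      s = edge (t.1 e₁) 0 e₁ := by
    intro s t hs ht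
    have hs' : s = edge (s.1 0) 0 e₁ := by
      refine eq_edge h01 fun k h0 h1 => ?_
      by_contra hne
      have hk1 := hxs s hs k hne
      have hk2 : t.1 k = 0 := by
        by_contra h
        exact h1 (he k hk1 (hys t ht k h))
      refine h0 (funext fun i => ?_)
      fin_cases i
      · exact hsum s t hs ht k (by rwa [hk2, add_zero])
      · exact hk1
    have h1 : s.1 e₁ + t.1 e₁ = 0 := by
      by_contra h
      simpa [e₁] using hsum s t hs ht e₁ h
    have h2 : s.1 e₁ = -s.1 0 := by
      rw [hs', edge_apply, edge_apply]
      simp [h01, h01.symm]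
    rw [h2] at h1
    rwa [← neg_add_eq_zero.1 h1]
  obtain ⟨t, ht⟩ := hex hy
  exact ⟨_, fun s hs => key s t hs ht⟩

end Shears

/-! ### Automorphisms permuting the unitaries `u(g)` up to scalars -/

section Phases

variable {G : Type*} [AddCommGroup G] {ν : Cocycle G} {α : AutVN ν} {a b a' b' : G} {z w : Circle}

lemma U_ne_zero (g : G) : U ν g ≠ 0 := by
  intro h
  have h1 : delta g = (0 : L2 G) := by
    rw [← U_delta_zero ν, h]
    rfl
  simpa [h1] using norm_delta g

lemma aut_smul (α : AutVN ν) (c : ℂ) (x : LVN ν) : α (c • x) = c • α x := map_smul α c x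

lemma aut_mul (α : AutVN ν) (x y : LVN ν) : α (x * y) = α x * α y := map_mul α x y

lemma aut_one (α : AutVN ν) : α 1 = 1 := map_one α

lemma circle_smul_smul (z w : Circle) (x : LVN ν) :
    (z : ℂ) • (w : ℂ) • x = ((z * w : Circle) : ℂ) • x := by
  rw [smul_smul, Circle.coe_mul]

lemma circle_smul_eq {x y : LVN ν} (h : x = (z : ℂ) • y) : y = ((z⁻¹ : Circle) : ℂ) • x := by
  rw [h, circle_smul_smul, inv_mul_cancel, Circle.coe_one, one_smul]

/-- The relation `α(u(a)) = z u(a')`. -/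
def ScalarMaps (α : AutVN ν) (a : G) (z : Circle) (a' : G) : Prop :=
  α (U ν a) = (z : ℂ) • U ν a'

lemma ScalarMaps.zero (α : AutVN ν) : ScalarMaps α 0 1 0 := by
  rw [ScalarMaps, U_zero, aut_one, Circle.coe_one, one_smul]

lemma ScalarMaps.add (ha : ScalarMaps α a z a') (hb : ScalarMaps α b w b') :
    ScalarMaps α (a + b) ((ν a b)⁻¹ * (z * w * ν a' b')) (a' + b') := by
  rw [ScalarMaps] at *
  rw [circle_smul_eq (U_mul ν a b), aut_smul, aut_mul, ha, hb, smul_mul_smul_comm, U_mul,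
    ← Circle.coe_mul, circle_smul_smul, circle_smul_smul, mul_assoc]

lemma ScalarMaps.unique (ha : ScalarMaps α a z a') (hb : ScalarMaps α a w b') : a' = b' ∧ z = w :=
  U_smul_inj ν (ha.symm.trans hb)

lemma ScalarMaps.trans {β : AutVN ν} {c : G} (ha : ScalarMaps α a z b) (hb : ScalarMaps β b w c) :
    ScalarMaps (α.trans β) a (z * w) c := by
  change β (α (U ν a)) = _
  rw [ha, aut_smul, hb, circle_smul_smul]

lemma ScalarMaps.symm (ha : ScalarMaps α a z b) : ScalarMaps α.symm b z⁻¹ a := by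
  have h1 := congrArg α.symm (circle_smul_eq ha)
  rwa [aut_smul, StarAlgEquiv.symm_apply_apply] at h1

/-- If `β` commutes with `α`, it transports the relation `α(u(a)) = z u(a')`. -/
lemma ScalarMaps.conj {β : AutVN ν} (hαβ : ∀ x, β (α x) = α (β x)) {c c' : Circle}
    (ha : ScalarMaps α a z a') (hb : ScalarMaps β a c b) (hb' : ScalarMaps β a' c' b') :
    ScalarMaps α b (c⁻¹ * (z * c')) b' := by
  rw [ScalarMaps, circle_smul_eq hb, aut_smul, ← hαβ, ha, aut_smul, hb', circle_smul_smul,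
    circle_smul_smul, mul_assoc]

lemma ScalarMaps.apply_eq {β : AutVN ν} (ha : ScalarMaps α a z b) (hb : ScalarMaps β a z b) :
    α (U ν a) = β (U ν a) :=
  Eq.trans ha (Eq.symm hb)

lemma apply_U_add_eq {β : AutVN ν} (ha : α (U ν a) = β (U ν a)) (hb : α (U ν b) = β (U ν b)) :
    α (U ν (a + b)) = β (U ν (a + b)) := by
  rw [circle_smul_eq (U_mul ν a b), aut_smul, aut_smul, aut_mul, aut_mul, ha, hb]

/-- The function `μ*μ` is the commutation factor of the unitaries `u(g)`, so it is preserved. -/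
lemma ScalarMaps.starMul (ha : ScalarMaps α a z a') (hb : ScalarMaps α b w b') :
    ν.starMul a' b' = ν.starMul a b := by
  have h1 := ha.add hb
  have h2 := hb.add ha
  rw [add_comm b a, add_comm b' a'] at h2
  have h3 := (h1.unique h2).2
  have h4 : (ν b' a')⁻¹ * ν a' b' = ((ν a b)⁻¹ * (z * w * ν a' b')) *
      ((ν b a)⁻¹ * (w * z * ν b' a'))⁻¹ * ((ν b a)⁻¹ * ν a b) := by
    apply Additive.ofMul.injective
    simp only [ofMul_mul, ofMul_inv]
    abel
  rw [Cocycle.starMul, Cocycle.starMul, h4, h3, mul_inv_cancel, one_mul]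

/-- If `α(u(h))` has a single nonzero coefficient, this coefficient has modulus `1`, since `α` is
isometric for the operator norm. -/
lemma exists_scalarMaps {g h : G} (hg : ∀ l, (α (U ν h)).1 (delta 0) l ≠ 0 → l = g) :
    ∃ z : Circle, ScalarMaps α h z g := by
  set x := α (U ν h) with hx
  set c := x.1 (delta 0) g with hc
  have h1 : x = c • U ν g := by
    refine LVN_ext ν ?_
    change _ = c • (U ν g).1 (delta 0)
    rw [U_delta_zero]
    exact eq_smul_delta hg
  have h2 : ∀ k : G, ‖(U ν k).1‖ = 1 := by
    intro k
    have : Nontrivial (L2 G →L[ℂ] L2 G) :=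
      ⟨(U ν k).1, 0, fun h => U_ne_zero (ν := ν) k (Subtype.ext h)⟩
    exact CStarRing.norm_coe_unitary (u ν k)
  have h3 : ‖c‖ = 1 := by
    have h4 : ‖x.1‖ = 1 := by rw [hx, norm_aut_apply, h2]
    rw [h1] at h4
    change ‖c • (U ν g).1‖ = 1 at h4
    rwa [norm_smul, h2, mul_one] at h4
  exact ⟨⟨c, mem_sphere_zero_iff_norm.2 h3⟩, h1⟩

end Phases

/-! ### The automorphism of `H` attached to an element of the centralizer -/

section EdgeMap

variable {H : Type*} [AddCommGroup H] {μ : Cocycle H} {χ : AddChar H Circle}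
  {α : AutVN (tildeLam μ)} {φ : H ≃+ H}

/-- The `*`-automorphism `α` commutes with the twisted Bernoulli action. -/
def CommutesBeta (χ : AddChar H Circle) (α : AutVN (tildeLam μ)) : Prop :=
  ∀ p x, beta μ χ p (α x) = α (beta μ χ p x)

lemma CommutesBeta.symm (hα : CommutesBeta χ α) : CommutesBeta χ α.symm := by
  intro p x
  refine EquivLike.injective α ?_
  exact (hα p _).symm.trans ((congrArg _ (α.apply_symm_apply x)).trans
    (α.apply_symm_apply _).symm)

lemma scalarMaps_beta (μ : Cocycle H) (χ : AddChar H Circle) (p : Gam) (l : Lam H) :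
    ScalarMaps (beta μ χ p) l (wt χ p l) (act p l) :=
  beta_U μ χ p l

lemma ScalarMaps.act (hα : CommutesBeta χ α) (p : Gam) {l l' : Lam H} {z : Circle}
    (h : ScalarMaps α l z l') :
    ScalarMaps α (act p l) ((wt χ p l)⁻¹ * (z * wt χ p l')) (TwistedBernoulli.act p l') :=
  h.conj (hα p) (scalarMaps_beta μ χ p l) (scalarMaps_beta μ χ p l')

lemma support_aut_U (hα : CommutesBeta χ α) {a d : Z2} (hd : d ≠ 0) {l₀ : Lam H}
    (hl₀ : ∀ n, act (shear a d n) l₀ = l₀) {l : Lam H}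
    (hl : (α (U (tildeLam μ) l₀)).1 (delta 0) l ≠ 0) {m : Z2} (hm : l.1 m ≠ 0) :
    det2 d (m - a) = 0 := by
  refine support_of_shear (χ := χ) hd (fun n => ⟨wt χ (shear a d n) l₀, ?_⟩) hl hm
  have h1 := scalarMaps_beta μ χ (shear a d n) l₀
  have h2 : ScalarMaps _ _ _ l₀ := (hl₀ n) ▸ h1
  exact (hα _ _).trans ((congrArg α h2).trans (aut_smul α _ _))

lemma act_shear_edge (a d : Z2) (n : ℤ) (h : H) :
    act (shear a d n) (edge h a (a + d)) = edge h a (a + d) := by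
  rw [act_edge, shear_smul, shear_smul]
  simp [det2, mul_comm]

lemma zero_ne_e₁ : (0 : Z2) ≠ e₁ := fun h => by simpa [e₁] using congrFun h 0

lemma zero_ne_e₂ : (0 : Z2) ≠ e₂ := fun h => by simpa [e₂] using congrFun h 1

lemma e₁_ne_e₂ : e₁ ≠ e₂ := fun h => by simpa [e₁, e₂] using congrFun h 0

lemma zero_ne_e₁_add_e₂ : (0 : Z2) ≠ e₁ + e₂ := fun h => by simpa [e₁, e₂] using congrFun h 0

lemma det2_hypotenuse (m : Z2) : det2 (e₂ - e₁) (m - e₁) = 1 - (m 0 + m 1) := by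
  simp [det2, e₁, e₂]
  ring

lemma aut_U_ne_zero {G : Type*} [AddCommGroup G] {ν : Cocycle G} (α : AutVN ν) (g : G) :
    α (U ν g) ≠ 0 := fun h =>
  U_ne_zero g (EquivLike.injective α (h.trans (map_zero α).symm))

lemma coeff_smul {G : Type*} [AddCommGroup G] {ν : Cocycle G} (c : ℂ) (x : LVN ν) (g : G) :
    (c • x).1 (delta 0) g = c * x.1 (delta 0) g := rfl

/-- The triangle with vertices `0`, `e₁`, `e₂`: the coefficients of the image of each side live on
the line through that side. -/
lemma exists_scalarMaps_edge (hα : CommutesBeta χ α) (h : H) :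
    ∃ g : H, ∃ z : Circle, ScalarMaps α (edge h 0 e₁) z (edge g 0 e₁) := by
  have hd : e₂ - e₁ ≠ 0 := sub_ne_zero.2 e₁_ne_e₂.symm
  have hmul : α (U (tildeLam μ) (edge h 0 e₁)) * α (U (tildeLam μ) (edge h e₁ e₂)) =
      (tildeLam μ (edge h 0 e₁) (edge h e₁ e₂) : ℂ) • α (U (tildeLam μ) (edge h 0 e₂)) := by
    refine (aut_mul α _ _).symm.trans ((congrArg α (U_mul _ _ _)).trans ((aut_smul α _ _).trans ?_))
    exact congrArg (fun l => _ • α (U (tildeLam μ) l)) (edge_add_edge h 0 e₁ e₂)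
  obtain ⟨g, hg⟩ := exists_edge_of_triangle (x := α (U (tildeLam μ) (edge h 0 e₁)))
    (y := α (U (tildeLam μ) (edge h e₁ e₂))) (aut_U_ne_zero α _)
    (fun l hl m hm => by
      have := support_aut_U hα (a := 0) zero_ne_e₁.symm
        (fun n => by simpa only [zero_add] using act_shear_edge 0 e₁ n h) hl hm
      simpa [det2, e₁] using this)
    (fun l hl m hm => by
      have := support_aut_U hα (a := e₁) hd
        (fun n => by simpa only [add_sub_cancel] using act_shear_edge e₁ (e₂ - e₁) n h) hl hm
      rw [det2_hypotenuse] at this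
      exact (sub_eq_zero.1 this).symm)
    (fun l hl m hm => by
      have hl' : (α (U (tildeLam μ) (edge h 0 e₂))).1 (delta 0) l ≠ 0 := by
        intro h0
        refine hl ((congrArg (fun x : N μ => x.1 (delta 0) l) hmul).trans ?_)
        exact (coeff_smul _ _ _).trans (mul_eq_zero_of_right _ h0)
      have := support_aut_U hα (a := 0) zero_ne_e₂.symm
        (fun n => by simpa only [zero_add] using act_shear_edge 0 e₂ n h) hl' hm
      simpa [det2, e₂] using this)
  exact ⟨g, exists_scalarMaps hg⟩

/-- The `*`-automorphism `α` maps `u(λ)` to a multiple of `u(φ ∘ λ)`, for every `λ`. -/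
def Implements (α : AutVN (tildeLam μ)) (φ : H ≃+ H) : Prop :=
  ∀ l : Lam H, ∃ z : Circle, ScalarMaps α l z (mapLam φ l)

lemma Implements.exists_edge (hφ : Implements α φ) (h : H) (a b : Z2) :
    ∃ z : Circle, ScalarMaps α (edge h a b) z (edge (φ h) a b) := by
  rw [← mapLam_edge]
  exact hφ _

lemma Implements.unique {φ' : H ≃+ H} (hφ : Implements α φ) (hφ' : Implements α φ') : φ = φ' := by
  ext h
  obtain ⟨z, hz⟩ := hφ.exists_edge h 0 e₁
  obtain ⟨w, hw⟩ := hφ'.exists_edge h 0 e₁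
  exact edge_injective zero_ne_e₁ (hz.unique hw).1

lemma Implements.trans {α' : AutVN (tildeLam μ)} {φ' : H ≃+ H} (hφ : Implements α φ)
    (hφ' : Implements α' φ') : Implements (α.trans α') (φ.trans φ') := by
  intro l
  obtain ⟨z, hz⟩ := hφ l
  obtain ⟨w, hw⟩ := hφ' (mapLam φ l)
  rw [mapLam_mapLam] at hw
  exact ⟨z * w, ScalarMaps.trans hz hw⟩

/-- The values on the `u(h δ_0 - h δ_{(1, 0)})` propagate to `Λ(H)`; the inverse of `φ` comes from
the inverse of `α`. -/
lemma exists_implements (hα : CommutesBeta χ α) : ∃ φ : H ≃+ H, Implements α φ := by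
  choose f z hz using exists_scalarMaps_edge hα
  choose g w hw using exists_scalarMaps_edge hα.symm
  have hinj := edge_injective (H := H) zero_ne_e₁
  have hgf : ∀ h, g (f h) = h := fun h => hinj ((hw (f h)).unique (hz h).symm).1
  have hfg : ∀ h, f (g h) = h := fun h => hinj ((hz (g h)).unique (hw h).symm).1
  have hadd : ∀ h h', f (h + h') = f h + f h' := by
    intro h h'
    have h1 := (hz h).add (hz h')
    rw [← edge_add, ← edge_add] at h1
    exact hinj ((hz _).unique h1).1
  refine ⟨{ toFun := f, invFun := g, left_inv := hgf, right_inv := hfg, map_add' := hadd },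
    fun l => ?_⟩
  induction l using Lam_induction with
  | hzero => exact ⟨1, (mapLam_zero (H := H) _).symm ▸ ScalarMaps.zero α⟩
  | hadd l l' hl hl' =>
    obtain ⟨z, hz⟩ := hl
    obtain ⟨w, hw⟩ := hl'
    rw [mapLam_add]
    exact ⟨_, hz.add hw⟩
  | hedge p h =>
    rw [mapLam_act, mapLam_edge]
    exact ⟨_, (hz h).act hα p⟩

lemma tildeLam_edge (μ : Cocycle H) (g h : H) {a b c : Z2} (hab : a ≠ b) (hbc : b ≠ c)
    (hac : a ≠ c) : tildeLam μ (edge g a b) (edge h b c) = μ (-g) h := by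
  change ∏ᶠ k, μ ((edge g a b).1 k) ((edge h b c).1 k) = _
  rw [finprod_eq_single _ b]
  · simp [edge_apply, hab.symm, hbc]
  · intro k hk
    by_cases hka : k = a
    · subst hka
      simp [edge_apply, hab, hac, μ.zero_right']
    · simp [edge_apply, hk, hka, μ.zero_left']

lemma Implements.starMul (hφ : Implements α φ) (g h : H) :
    μ.starMul (φ g) (φ h) = μ.starMul g h := by
  have key : ∀ g h : H, (tildeLam μ).starMul (edge (-g) 0 e₁) (edge h e₁ e₂) = μ.starMul g h := by
    intro g h
    have h1 : tildeLam μ (edge h e₁ e₂) (edge (-g) 0 e₁) = μ h g := by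
      rw [edge_swap, edge_swap (-g), tildeLam_edge μ _ _ e₁_ne_e₂.symm zero_ne_e₁.symm
        zero_ne_e₂.symm, neg_neg, neg_neg]
    rw [Cocycle.starMul, h1, tildeLam_edge μ _ _ zero_ne_e₁ e₁_ne_e₂ zero_ne_e₂, neg_neg]
    rfl
  obtain ⟨z, hz⟩ := hφ.exists_edge (-g) 0 e₁
  obtain ⟨w, hw⟩ := hφ.exists_edge h e₁ e₂
  have h1 := hz.starMul hw
  rwa [map_neg, key, key] at h1

lemma wt_transl_edge (χ : AddChar H Circle) (k : Z2) (A : SL(2, ℤ)) (h : H) :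
    wt χ (transl k A) (edge h 0 e₁) = (χ h ^ det2 k (A.1.mulVec e₁))⁻¹ := by
  rw [wt_eq, finprod_eq_single _ e₁]
  · have h1 : (edge h 0 e₁).1 e₁ = -h := by simp [edge_apply, zero_ne_e₁.symm]
    rw [h1, AddChar.map_neg_eq_inv, inv_zpow]
    rfl
  · intro m hm
    by_cases h0 : m = 0
    · subst h0
      simp [det2]
    · simp [edge_apply, hm, h0]

lemma ScalarMaps.transl (hα : CommutesBeta χ α) {h g : H} {z : Circle}
    (hz : ScalarMaps α (edge h 0 e₁) z (edge g 0 e₁)) (k : Z2) (A : SL(2, ℤ)) :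
    ScalarMaps α (edge h k (k + A.1.mulVec e₁))
      (z * (χ h * (χ g)⁻¹) ^ det2 k (A.1.mulVec e₁)) (edge g k (k + A.1.mulVec e₁)) := by
  have h1 := hz.act hα (TwistedBernoulli.transl k A)
  rwa [act_edge, act_edge, transl_smul_zero, transl_smul, wt_transl_edge, wt_transl_edge, inv_inv,
    mul_left_comm, ← inv_zpow, ← mul_zpow] at h1

lemma ScalarMaps.linear (hα : CommutesBeta χ α) {h g : H} {z : Circle}
    (hz : ScalarMaps α (edge h 0 e₁) z (edge g 0 e₁)) (A : SL(2, ℤ)) :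
    ScalarMaps α (edge h 0 (A.1.mulVec e₁)) z (edge g 0 (A.1.mulVec e₁)) := by
  have h1 := hz.transl hα 0 A
  rwa [zero_add, show det2 0 (A.1.mulVec e₁) = 0 by simp [det2], zpow_zero, mul_one] at h1

/-- The scalar at `h δ_0 - h δ_{(1, 0)}`, computed along the edges of a triangle with a vertex
at `0`. -/
lemma phase_of_triangle (hα : CommutesBeta χ α) {h g : H} {z : Circle}
    (hz : ScalarMaps α (edge h 0 e₁) z (edge g 0 e₁))
    (A B C : SL(2, ℤ)) (hC : C.1.mulVec e₁ = A.1.mulVec e₁ + B.1.mulVec e₁)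
    (hA : 0 ≠ A.1.mulVec e₁) (hB : 0 ≠ B.1.mulVec e₁) (hC0 : 0 ≠ C.1.mulVec e₁) :
    z * (χ h * (χ g)⁻¹) ^ det2 (A.1.mulVec e₁) (B.1.mulVec e₁) = μ (-h) h * (μ (-g) g)⁻¹ := by
  have h1 := hz.linear hα A
  have h2 := hz.transl hα (A.1.mulVec e₁) B
  have h3 := hz.linear hα C
  have h4 := h1.add h2
  have hAC : A.1.mulVec e₁ ≠ C.1.mulVec e₁ := by
    rw [hC]
    exact fun h => hB (left_eq_add.1 h).symm
  rw [← hC, edge_add_edge, edge_add_edge, tildeLam_edge μ _ _ hA hAC hC0,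
    tildeLam_edge μ _ _ hA hAC hC0] at h4
  have h5 := (h3.unique h4).2
  set t := (χ h * (χ g)⁻¹) ^ det2 (A.1.mulVec e₁) (B.1.mulVec e₁)
  set p := μ (-h) h
  set q := μ (-g) g
  have h6 : z * t = (p⁻¹ * (z * (z * t) * q)) * z⁻¹ * (p * q⁻¹) := by
    apply Additive.ofMul.injective
    simp only [ofMul_mul, ofMul_inv]
    abel
  rw [h6, ← h5, mul_inv_cancel, one_mul]

lemma one_mulVec_e₁ : (1 : SL(2, ℤ)).1.mulVec e₁ = e₁ := by simp

/-- The triangle `0, (1, 0), (1, 1)` determines the scalar in terms of `μ`, `χ`, `h` and `g`. -/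
lemma phase_eq (hα : CommutesBeta χ α) {h g : H} {z : Circle}
    (hz : ScalarMaps α (edge h 0 e₁) z (edge g 0 e₁)) :
    z * (χ h * (χ g)⁻¹) = μ (-h) h * (μ (-g) g)⁻¹ := by
  have h1 := phase_of_triangle hα hz 1 rot unip
  rw [one_mulVec_e₁, rot_e₁, unip_e₁, show det2 e₁ e₂ = 1 by simp [det2, e₁, e₂], zpow_one] at h1
  exact h1 rfl zero_ne_e₁ zero_ne_e₂ zero_ne_e₁_add_e₂

/-- Two triangles of opposite orientations give the same scalar, so `χ(φ(h)) / χ(h)` equals its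
inverse. -/
lemma Implements.char_sq (hα : CommutesBeta χ α) (hφ : Implements α φ) (h : H) :
    χ (φ h) ^ 2 = χ h ^ 2 := by
  obtain ⟨z, hz⟩ := hφ.exists_edge h 0 e₁
  have h1 := phase_of_triangle hα hz rot 1 unip
  rw [one_mulVec_e₁, rot_e₁, unip_e₁, show det2 e₂ e₁ = -1 by simp [det2, e₁, e₂], zpow_neg,
    zpow_one] at h1
  have h2 := (phase_eq hα hz).trans
    (h1 (add_comm _ _) zero_ne_e₂ zero_ne_e₁ zero_ne_e₁_add_e₂).symm
  have h3 := mul_left_cancel h2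
  rw [mul_inv, inv_inv] at h3
  have h4 := congrArg (fun t => t * (χ h * χ (φ h))) h3
  have h5 : χ h * (χ (φ h))⁻¹ * (χ h * χ (φ h)) = χ h ^ 2 := by
    rw [mul_mul_mul_comm, inv_mul_cancel, mul_one, sq]
  have h6 : (χ h)⁻¹ * χ (φ h) * (χ h * χ (φ h)) = χ (φ h) ^ 2 := by
    rw [mul_mul_mul_comm, inv_mul_cancel, one_mul, sq]
  exact (h5.symm.trans (h4.trans h6)).symm

/-- The value of `α` at `u(λ)` depends on finitely many values of `φ` only. -/
lemma exists_finset_aut_U_eq (μ : Cocycle H) (χ : AddChar H Circle) (l : Lam H) :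
    ∃ F : Finset H, ∀ (α α' : AutVN (tildeLam μ)) (φ φ' : H ≃+ H), CommutesBeta χ α →
      CommutesBeta χ α' → Implements α φ → Implements α' φ' → (∀ h ∈ F, φ h = φ' h) →
        α (U (tildeLam μ) l) = α' (U (tildeLam μ) l) := by
  classical
  induction l using Lam_induction with
  | hzero =>
    exact ⟨∅, fun α α' _ _ _ _ _ _ _ => (ScalarMaps.zero α).apply_eq (ScalarMaps.zero α')⟩
  | hadd l l' hl hl' =>
    obtain ⟨F, hF⟩ := hl
    obtain ⟨F', hF'⟩ := hl'
    refine ⟨F ∪ F', fun α α' φ φ' hα hα' hφ hφ' h => apply_U_add_eq ?_ ?_⟩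
    · exact hF α α' φ φ' hα hα' hφ hφ' fun h' hh' => h h' (Finset.mem_union_left _ hh')
    · exact hF' α α' φ φ' hα hα' hφ hφ' fun h' hh' => h h' (Finset.mem_union_right _ hh')
  | hedge p h =>
    refine ⟨{h}, fun α α' φ φ' hα hα' hφ hφ' hh => ?_⟩
    have hh := hh h (Finset.mem_singleton_self h)
    obtain ⟨z, hz⟩ := hφ.exists_edge h 0 e₁
    obtain ⟨w, hw⟩ := hφ'.exists_edge h 0 e₁
    rw [hh] at hz
    have h3 : z = w := mul_right_cancel ((phase_eq hα hz).trans (phase_eq hα' hw).symm)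
    rw [h3] at hz
    exact (hz.act hα p).apply_eq (hw.act hα' p)

lemma Implements.aut_eq {α' : AutVN (tildeLam μ)} (hα : CommutesBeta χ α)
    (hα' : CommutesBeta χ α') (hφ : Implements α φ) (hφ' : Implements α' φ) : α = α' := by
  refine aut_ext_U fun l => ?_
  obtain ⟨F, hF⟩ := exists_finset_aut_U_eq μ χ l
  exact hF α α' φ φ hα hα' hφ hφ' fun _ _ => rfl

end EdgeMap

/-! ### Symmetric cocycles are coboundaries -/

section Coboundary

/-- The underlying set of the extension of `H` by the circle given by a symmetric cocycle. -/
structure CircleExt {H : Type*} [AddCommGroup H] (ν : Cocycle H) where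
  base : H
  phase : Circle

namespace CircleExt

variable {H : Type*} [AddCommGroup H] {ν : Cocycle H}

lemma ext' {x y : CircleExt ν} (h1 : x.base = y.base) (h2 : x.phase = y.phase) : x = y := by
  cases x
  cases y
  cases h1
  cases h2
  rfl

/-- The extension `0 → 𝕋 → E → H → 0` given by a symmetric cocycle. -/
@[reducible] def addCommGroup (hν : ∀ g h, ν g h = ν h g) : AddCommGroup (CircleExt ν) where
  add x y := ⟨x.base + y.base, x.phase * y.phase * ν x.base y.base⟩
  zero := ⟨0, 1⟩
  neg x := ⟨-x.base, (x.phase * ν (-x.base) x.base)⁻¹⟩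
  nsmul := @nsmulRec _ ⟨⟨0, 1⟩⟩
    ⟨fun x y => ⟨x.base + y.base, x.phase * y.phase * ν x.base y.base⟩⟩
  zsmul := @zsmulRec _ ⟨⟨0, 1⟩⟩
    ⟨fun x y => ⟨x.base + y.base, x.phase * y.phase * ν x.base y.base⟩⟩
    ⟨fun x => ⟨-x.base, (x.phase * ν (-x.base) x.base)⁻¹⟩⟩
    (@nsmulRec _ ⟨⟨0, 1⟩⟩
    ⟨fun x y => ⟨x.base + y.base, x.phase * y.phase * ν x.base y.base⟩⟩)
  add_assoc x y z := by
    refine ext' (add_assoc _ _ _) ?_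
    change x.phase * y.phase * ν x.base y.base * z.phase * ν (x.base + y.base) z.base =
      x.phase * (y.phase * z.phase * ν y.base z.base) * ν x.base (y.base + z.base)
    have h := ν.cocycle' x.base y.base z.base
    calc _ = x.phase * y.phase * z.phase * (ν x.base y.base * ν (x.base + y.base) z.base) := by
          ac_rfl
      _ = _ := by
          rw [h]
          ac_rfl
  zero_add x := by
    refine ext' (zero_add _) ?_
    change 1 * x.phase * ν 0 x.base = x.phase
    rw [ν.zero_left', one_mul, mul_one]
  add_zero x := by
    refine ext' (add_zero _) ?_
    change x.phase * 1 * ν x.base 0 = x.phase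
    rw [ν.zero_right', mul_one, mul_one]
  neg_add_cancel x := by
    refine ext' (neg_add_cancel _) ?_
    change (x.phase * ν (-x.base) x.base)⁻¹ * x.phase * ν (-x.base) x.base = 1
    rw [mul_assoc, inv_mul_cancel]
  add_comm x y := by
    refine ext' (add_comm _ _) ?_
    change x.phase * y.phase * ν x.base y.base = y.phase * x.phase * ν y.base x.base
    rw [hν, mul_comm x.phase]

end CircleExt

/-- The circle is a divisible group. -/
@[reducible] def circleDivisible : DivisibleBy (Additive Circle) ℤ where
  div z n := Additive.ofMul (Circle.exp ((Complex.arg z.toMul) / n))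
  div_zero z := by simp
  div_cancel {n} z hn := by
    have hn' : (n : ℝ) ≠ 0 := Int.cast_ne_zero.2 hn
    change Additive.ofMul (Circle.exp ((Complex.arg z.toMul) / n) ^ n) = z
    rw [← Circle.exp_intCast_mul, mul_div_cancel₀ _ hn', Circle.exp_arg]
    rfl

/-- A symmetric cocycle defines an abelian extension by the circle, which splits since the circle
is divisible. -/
lemma exists_coboundary {H : Type*} [AddCommGroup H] (ν : Cocycle H)
    (hν : ∀ g h, ν g h = ν h g) :
    ∃ ζ : H → Circle, ∀ g h, ζ g * ζ h = ν g h * ζ (g + h) := by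
  let _ := CircleExt.addCommGroup hν
  let _ := circleDivisible
  let i : Additive Circle →+ CircleExt ν :=
    { toFun := fun z => ⟨0, z.toMul⟩
      map_zero' := rfl
      map_add' := fun z w => by
        refine CircleExt.ext' (add_zero 0).symm ?_
        change z.toMul * w.toMul = z.toMul * w.toMul * ν 0 0
        rw [ν.zero_left', mul_one] }
  have hi : Function.Injective i := fun z w h => congrArg CircleExt.phase h
  obtain ⟨r, hr⟩ := (Module.Baer.of_divisible (Additive Circle)).extension_property_addMonoidHom
    i hi (AddMonoidHom.id _)
  refine ⟨fun g => (r ⟨g, 1⟩).toMul, fun g h => ?_⟩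
  have h1 : (⟨g, 1⟩ : CircleExt ν) + ⟨h, 1⟩ = i (Additive.ofMul (ν g h)) + ⟨g + h, 1⟩ := by
    refine CircleExt.ext' (zero_add _).symm ?_
    change 1 * 1 * ν g h = ν g h * 1 * ν 0 (g + h)
    rw [ν.zero_left', one_mul, one_mul, mul_one, mul_one]
  have h2 := congrArg r h1
  rw [map_add, map_add] at h2
  have h3 : r (i (Additive.ofMul (ν g h))) = Additive.ofMul (ν g h) := DFunLike.congr_fun hr _
  rw [h3] at h2
  exact congrArg Additive.toMul h2

end Coboundary

/-! ### Automorphisms implemented by twisted permutations -/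

section MonomialAut

variable {G : Type*} [AddCommGroup G] {ν : Cocycle G} {e : G ≃+ G} {z : G → Circle}

/-- Conjugation by the unitary `δ_g ↦ z(g) δ_{e(g)}`. -/
abbrev conjMonomial (e : G ≃+ G) (z : G → Circle) :
    (L2 G →L[ℂ] L2 G) ≃⋆ₐ[ℂ] (L2 G →L[ℂ] L2 G) :=
  Unitary.conjStarAlgAut ℂ (L2 G →L[ℂ] L2 G) (monomial e.toEquiv z)

lemma conjMonomial_u (hz : ∀ g h, z (g + h) * ν g h = z g * z h * ν (e g) (e h)) (g : G) :
    conjMonomial e z (u ν g) = (z g : ℂ) • (u ν (e g) : L2 G →L[ℂ] L2 G) := by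
  have h1 : (monomial e.toEquiv z : L2 G →L[ℂ] L2 G) * u ν g =
      (z g : ℂ) • ((u ν (e g) : L2 G →L[ℂ] L2 G) * monomial e.toEquiv z) := by
    refine ext_delta fun h => ?_
    change (monomial e.toEquiv z : L2 G →L[ℂ] L2 G) ((u ν g : L2 G →L[ℂ] L2 G) (delta h)) =
      (z g : ℂ) • (u ν (e g) : L2 G →L[ℂ] L2 G)
        ((monomial e.toEquiv z : L2 G →L[ℂ] L2 G) (delta h))
    rw [u_delta, map_smul, monomial_delta, monomial_delta, map_smul]
    change _ = (z g : ℂ) • (z h : ℂ) • (u ν (e g) : L2 G →L[ℂ] L2 G) (delta (e h))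
    rw [u_delta, smul_smul, smul_smul, smul_smul, ← Circle.coe_mul, ← Circle.coe_mul,
      ← Circle.coe_mul, mul_comm (ν g h), hz, ← map_add]
    rfl
  rw [Unitary.conjStarAlgAut_apply, h1, smul_mul_assoc, mul_assoc]
  simp

lemma conjMonomial_comm_iff (hz : ∀ g h, z (g + h) * ν g h = z g * z h * ν (e g) (e h))
    (y : L2 G →L[ℂ] L2 G) :
    (∀ g, (u ν g : L2 G →L[ℂ] L2 G) * conjMonomial e z y = conjMonomial e z y * u ν g ∧
      star (u ν g : L2 G →L[ℂ] L2 G) * conjMonomial e z y =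
        conjMonomial e z y * star (u ν g : L2 G →L[ℂ] L2 G)) ↔
    ∀ g, (u ν g : L2 G →L[ℂ] L2 G) * y = y * u ν g ∧
      star (u ν g : L2 G →L[ℂ] L2 G) * y = y * star (u ν g : L2 G →L[ℂ] L2 G) := by
  refine e.surjective.forall.trans (forall_congr' fun g => and_congr ?_ ?_)
  · refine Iff.trans ?_ (EquivLike.injective (conjMonomial e z)).eq_iff
    rw [map_mul, map_mul,
      conjMonomial_u hz, smul_mul_assoc, mul_smul_comm,
      smul_right_injective _ (Circle.coe_ne_zero (z g)) |>.eq_iff]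
  · refine Iff.trans ?_ (EquivLike.injective (conjMonomial e z)).eq_iff
    rw [map_mul, map_mul, map_star,
      conjMonomial_u hz, star_smul, smul_mul_assoc, mul_smul_comm,
      smul_right_injective _ (star_ne_zero.2 (Circle.coe_ne_zero (z g))) |>.eq_iff]

lemma conjMonomial_mem_iff (hz : ∀ g h, z (g + h) * ν g h = z g * z h * ν (e g) (e h))
    (x : L2 G →L[ℂ] L2 G) :
    conjMonomial e z x ∈ (groupVN ν).toStarSubalgebra ↔ x ∈ (groupVN ν).toStarSubalgebra := by
  rw [mem_groupVN, mem_groupVN, (EquivLike.surjective (conjMonomial e z)).forall]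
  refine forall_congr' fun y => imp_congr (conjMonomial_comm_iff hz y) ?_
  rw [← map_mul, ← map_mul, (EquivLike.injective (conjMonomial e z)).eq_iff]

/-- The `*`-automorphism `u(g) ↦ z(g) u(e(g))` of `L_ν(G)`, for `z` relating `ν` to `ν ∘ (e × e)`. -/
def monomialAut (hz : ∀ g h, z (g + h) * ν g h = z g * z h * ν (e g) (e h)) : AutVN ν where
  toFun x := ⟨conjMonomial e z x, (conjMonomial_mem_iff hz x.1).2 x.2⟩
  invFun x := ⟨(conjMonomial e z).symm x, (conjMonomial_mem_iff hz _).1 (by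
    rw [StarAlgEquiv.apply_symm_apply]
    exact x.2)⟩
  left_inv x := Subtype.ext ((conjMonomial e z).symm_apply_apply x.1)
  right_inv x := Subtype.ext ((conjMonomial e z).apply_symm_apply x.1)
  map_mul' x y := Subtype.ext (map_mul (conjMonomial e z) x.1 y.1)
  map_add' x y := Subtype.ext (map_add (conjMonomial e z) x.1 y.1)
  map_star' x := Subtype.ext (map_star (conjMonomial e z) x.1)
  map_smul' c x := Subtype.ext (map_smul (conjMonomial e z) c x.1)

lemma scalarMaps_monomialAut (hz : ∀ g h, z (g + h) * ν g h = z g * z h * ν (e g) (e h)) (g : G) :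
    ScalarMaps (monomialAut hz) g (z g) (e g) :=
  Subtype.ext (conjMonomial_u hz g)

lemma norm_monomialAut (hz : ∀ g h, z (g + h) * ν g h = z g * z h * ν (e g) (e h)) (x : LVN ν) :
    ‖(monomialAut hz x).1 (delta 0)‖ = ‖x.1 (delta 0)‖ := by
  have hz0 : z 0 = 1 := by
    have h := hz 0 0
    rw [map_zero, add_zero] at h
    exact (left_eq_mul.1 (mul_right_cancel h))
  have h1 : (monomial e.toEquiv z : L2 G →L[ℂ] L2 G) (delta 0) = delta 0 := by
    rw [monomial_delta, hz0, Circle.coe_one, one_smul]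
    exact congrArg delta (map_zero e)
  have h2 : star (monomial e.toEquiv z : L2 G →L[ℂ] L2 G) (delta 0) = delta 0 := by
    conv_lhs => rw [← h1]
    exact DFunLike.congr_fun (Unitary.coe_star_mul_self (monomial e.toEquiv z)) (delta 0)
  change ‖(monomial e.toEquiv z : L2 G →L[ℂ] L2 G) (x.1 (star (monomial e.toEquiv z :
    L2 G →L[ℂ] L2 G) (delta 0)))‖ = _
  rw [h2]
  exact (monomialIso e.toEquiv z).norm_map _

end MonomialAut

/-! ### The automorphism implementing an element of `Aut(H, μ*μ, χ²)` -/

section Construction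

/-- A quadratic function on `ℤ²` whose reduction modulo `2` is the indicator function of the
nonzero vectors. Modulo `2` it is `SL(2, ℤ)`-invariant, and its polarization is `det2`. -/
def quad (m : Z2) : ℤ := m 0 * m 1 + m 0 + m 1

lemma quad_smul (p : Gam) (m : Z2) : ∃ c : ℤ, quad (p • m) =
    quad m + det2 p.left.toAdd (p.right.1.mulVec m) + quad p.left.toAdd + 2 * c := by
  -- invariance under matrices of determinant `1` is checked on the finitely many residues
  have key : ∀ a b c d x y : ZMod 2, a * d - b * c = 1 →
      (a * x + b * y) * (c * x + d * y) + (a * x + b * y) + (c * x + d * y) =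
        x * y + x + y := by
    decide
  have hdet := p.right.2
  rw [Matrix.det_fin_two] at hdet
  obtain ⟨c, hc⟩ : (2 : ℤ) ∣ quad (p.right.1.mulVec m) - quad m := by
    rw [← Nat.cast_ofNat, ← ZMod.intCast_zmod_eq_zero_iff_dvd]
    have h := key (p.right.1 0 0) (p.right.1 0 1) (p.right.1 1 0) (p.right.1 1 1) (m 0) (m 1) (by
      exact_mod_cast congrArg (Int.cast : ℤ → ZMod 2) hdet)
    simp only [quad, Matrix.mulVec, dotProduct, Fin.sum_univ_two]
    push_cast
    rw [h, sub_self]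
  refine ⟨c + p.left.toAdd 1 * (p.right.1.mulVec m) 0, ?_⟩
  rw [gam_smul_def]
  have hadd : ∀ k n : Z2, quad (k + n) = quad k + quad n + det2 k n + 2 * (k 1 * n 0) := by
    intro k n
    simp only [quad, det2, Pi.add_apply]
    ring
  rw [hadd]
  linear_combination hc

variable {H : Type*} [AddCommGroup H]

lemma hasFiniteMulSupport_Lam {f : Z2 → H → Circle} (hf : ∀ m, f m 0 = 1) (l : Lam H) :
    Function.HasFiniteMulSupport fun m => f m (l.1 m) := by
  refine l.1.hasFiniteSupport.subset fun k hk => ?_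
  contrapose! hk
  simp only [Function.mem_support, not_not] at hk
  simp [hk, hf]

/-- Functions constant in `m` do not contribute to the phases, since `∑ λ(m) = 0`. -/
lemma finprod_char_Lam (η : AddChar H Circle) (l : Lam H) (n : ℤ) :
    ∏ᶠ m, η (l.1 m) ^ n = 1 := by
  have h0 : ∑ᶠ k, l.1 k = 0 := l.2
  rw [finsum_eq_sum_of_support_subset (s := l.1.support) _ (by simp)] at h0
  rw [finprod_eq_prod_of_mulSupport_subset (s := l.1.support), Finset.prod_zpow]
  · have h1 := map_prod η.toMonoidHom (fun k => Multiplicative.ofAdd (l.1 k)) l.1.support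
    rw [← ofAdd_sum, h0] at h1
    change η 0 = ∏ k ∈ l.1.support, η (l.1 k) at h1
    rw [← h1, AddChar.map_zero_eq_one, one_zpow]
  · intro k hk
    contrapose! hk
    have : l.1 k = 0 := by simpa using hk
    simp [this]

/-- `λ ↦ φ ∘ λ` as an automorphism of `Λ(H)`. -/
def mapLamEquiv (φ : H ≃+ H) : Lam H ≃+ Lam H where
  toFun := mapLam φ
  invFun := mapLam φ.symm
  left_inv _ := Lam_ext fun _ => φ.symm_apply_apply _
  right_inv _ := Lam_ext fun _ => φ.apply_symm_apply _
  map_add' := mapLam_add φ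

/-- The scalars `z(λ) = ∏_m ζ(λ(m))⁻¹ η(λ(m)) ^ q(m)`. -/
def phaseLam (ζ : H → Circle) (η : AddChar H Circle) (l : Lam H) : Circle :=
  ∏ᶠ m, (ζ (l.1 m))⁻¹ * η (l.1 m) ^ quad m

variable {μ : Cocycle H} {χ : AddChar H Circle} {φ : H ≃+ H} {ζ : H → Circle}

lemma phaseLam_add (η : AddChar H Circle) (hζ0 : ζ 0 = 1)
    (hζ : ∀ g h, ζ g * ζ h = μ (φ g) (φ h) * (μ g h)⁻¹ * ζ (g + h)) (a b : Lam H) :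
    phaseLam ζ η (a + b) * tildeLam μ a b =
      phaseLam ζ η a * phaseLam ζ η b * tildeLam μ (mapLam φ a) (mapLam φ b) := by
  have h1 : ∀ m, (ζ 0)⁻¹ * η 0 ^ quad m = 1 := fun m => by simp [hζ0]
  have h2 := fun l : Lam H =>
    hasFiniteMulSupport_Lam (f := fun m x => (ζ x)⁻¹ * η x ^ quad m) h1 l
  have h3 : ∀ a b : Lam H, Function.HasFiniteMulSupport fun m => μ (a.1 m) (b.1 m) := fun a b =>
    hasFiniteMulSupport_Lam (f := fun m x => μ x (b.1 m)) (fun m => μ.zero_left' _) a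
  have h4 : Function.HasFiniteMulSupport fun m => (ζ (a.1 m))⁻¹ * η (a.1 m) ^ quad m *
      ((ζ (b.1 m))⁻¹ * η (b.1 m) ^ quad m) := (h2 a).mul (h2 b)
  change (∏ᶠ m, _) * (∏ᶠ m, μ (a.1 m) (b.1 m)) = (∏ᶠ m, _) * (∏ᶠ m, _) *
    ∏ᶠ m, μ ((mapLam φ a).1 m) ((mapLam φ b).1 m)
  rw [← finprod_mul_distrib (h2 _) (h3 _ _), ← finprod_mul_distrib (h2 _) (h2 _),
    ← finprod_mul_distrib h4 (h3 _ _)]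
  refine finprod_congr fun m => ?_
  change (ζ (a.1 m + b.1 m))⁻¹ * η (a.1 m + b.1 m) ^ quad m * _ = _
  rw [mapLam_apply, mapLam_apply, AddChar.map_add_eq_mul, mul_zpow]
  set x := η (a.1 m) ^ quad m
  set y := η (b.1 m) ^ quad m
  have h5 : (ζ (a.1 m))⁻¹ * x * ((ζ (b.1 m))⁻¹ * y) * μ (φ (a.1 m)) (φ (b.1 m)) =
      (ζ (a.1 m) * ζ (b.1 m))⁻¹ * (μ (φ (a.1 m)) (φ (b.1 m)) * (x * y)) := by
    rw [mul_inv]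
    ac_rfl
  rw [h5, hζ, mul_inv, mul_inv, inv_inv]
  set t := μ (φ (a.1 m)) (φ (b.1 m))
  apply Additive.ofMul.injective
  simp only [ofMul_mul, ofMul_inv]
  abel

/-- The factor `η ^ q` of `phaseLam` absorbs the failure of `χ` to be `φ`-invariant. -/
lemma phaseLam_act (hζ0 : ζ 0 = 1) {η : AddChar H Circle} (hη : ∀ h, η h * χ h = χ (φ h))
    (hη2 : ∀ h, η h ^ 2 = 1) (p : Gam) (l : Lam H) :
    phaseLam ζ η (act p l) * wt χ p l = wt χ p (mapLam φ l) * phaseLam ζ η l := by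
  have h1 : phaseLam ζ η (act p l) = ∏ᶠ m, (ζ (l.1 m))⁻¹ * η (l.1 m) ^ quad (p • m) := by
    refine (finprod_comp_equiv (f := fun m => (ζ ((act p l).1 m))⁻¹ * η ((act p l).1 m) ^ quad m)
      (MulAction.toPerm p)).symm.trans (finprod_congr fun m => ?_)
    rw [MulAction.toPerm_apply, act_apply, inv_smul_smul]
  have hs1 : ∀ n : Z2 → ℤ, ∀ m, (ζ 0)⁻¹ * η 0 ^ n m = 1 := fun n m => by simp [hζ0]
  have hs2 : ∀ (ψ : AddChar H Circle) (n : Z2 → ℤ), ∀ m, ψ 0 ^ n m = 1 := fun ψ n m => by simp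
  have hs3 := fun n =>
    hasFiniteMulSupport_Lam (f := fun m x => (ζ x)⁻¹ * η x ^ n m) (hs1 n) l
  have hs4 := fun ψ n (l : Lam H) =>
    hasFiniteMulSupport_Lam (f := fun m x => ψ x ^ n m) (hs2 ψ n) l
  have hs5 : Function.HasFiniteMulSupport fun m =>
      χ ((mapLam φ l).1 m) ^ det2 p.left.toAdd (p.right.1.mulVec m) *
        ((ζ (l.1 m))⁻¹ * η (l.1 m) ^ quad m) := (hs4 χ _ (mapLam φ l)).mul (hs3 quad)
  have hs6 : Function.HasFiniteMulSupport fun m => η (l.1 m) ^ quad p.left.toAdd :=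
    hs4 η (fun _ => quad p.left.toAdd) l
  rw [h1, wt_eq, wt_eq, phaseLam, ← finprod_mul_distrib (hs3 _) (hs4 _ _ _),
    ← mul_one (_ * ∏ᶠ m, (ζ (l.1 m))⁻¹ * η (l.1 m) ^ quad m),
    ← finprod_char_Lam η l (quad p.left.toAdd), ← finprod_mul_distrib (hs4 _ _ _) (hs3 _),
    ← finprod_mul_distrib hs5 hs6]
  refine finprod_congr fun m => ?_
  obtain ⟨c, hc⟩ := quad_smul p m
  rw [mapLam_apply, ← hη, hc, zpow_add, zpow_add, zpow_add, zpow_mul, mul_zpow]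
  have h2 : η (l.1 m) ^ (2 : ℤ) = 1 := by exact_mod_cast hη2 (l.1 m)
  rw [h2, one_zpow, mul_one]
  apply Additive.ofMul.injective
  simp only [ofMul_mul, ofMul_inv]
  abel

/-- If `φ` preserves `μ*μ`, the cocycle `μ ∘ (φ × φ) / μ` is symmetric, so it is the coboundary of
some `ζ`. -/
lemma exists_coboundary_of_starMul (hφ : ∀ g h, μ.starMul (φ g) (φ h) = μ.starMul g h) :
    ∃ ζ : H → Circle, ζ 0 = 1 ∧ ∀ g h, ζ g * ζ h = μ (φ g) (φ h) * (μ g h)⁻¹ * ζ (g + h) := by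
  let ν : Cocycle H :=
    { toFun := fun g h => μ (φ g) (φ h) * (μ g h)⁻¹
      cocycle' := fun g h k => by
        have h1 := μ.cocycle' g h k
        have h2 := μ.cocycle' (φ g) (φ h) (φ k)
        rw [map_add, map_add, mul_mul_mul_comm, mul_mul_mul_comm (μ (φ h) (φ k)), ← mul_inv,
          ← mul_inv, h1, h2]
      zero_left' := fun g => by rw [map_zero, μ.zero_left', μ.zero_left', inv_one, mul_one]
      zero_right' := fun g => by rw [map_zero, μ.zero_right', μ.zero_right', inv_one, mul_one] }
  obtain ⟨ζ, hζ⟩ := exists_coboundary ν fun g h => by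
    change μ (φ g) (φ h) * (μ g h)⁻¹ = μ (φ h) (φ g) * (μ h g)⁻¹
    have h1 : (μ (φ h) (φ g))⁻¹ * μ (φ g) (φ h) = (μ h g)⁻¹ * μ g h := hφ g h
    rw [mul_inv_eq_iff_eq_mul, mul_assoc, ← h1, mul_inv_cancel_left]
  refine ⟨ζ, ?_, hζ⟩
  have h := hζ 0 0
  rw [ν.zero_left', add_zero, one_mul] at h
  exact left_eq_mul.1 h.symm

lemma conjStarAlgAut_comm {A : Type*} [Ring A] [StarRing A] [Algebra ℂ A] {v w : unitary A}
    (h : v * w = w * v) (x : A) :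
    Unitary.conjStarAlgAut ℂ A v (Unitary.conjStarAlgAut ℂ A w x) =
      Unitary.conjStarAlgAut ℂ A w (Unitary.conjStarAlgAut ℂ A v x) := by
  have h2 := DFunLike.congr_fun (congrArg (Unitary.conjStarAlgAut ℂ A) h) x
  rwa [map_mul, map_mul] at h2

lemma commutesBeta_monomialAut {z : Lam H → Circle}
    (hz : ∀ a b : Lam H, z (a + b) * tildeLam μ a b =
      z a * z b * tildeLam μ (mapLamEquiv φ a) (mapLamEquiv φ b))
    (hact : ∀ p l, z (act p l) * wt χ p l = wt χ p (mapLam φ l) * z l) :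
    CommutesBeta χ (monomialAut hz) := by
  intro p x
  have hcomm : W χ p * monomial (mapLamEquiv φ).toEquiv z =
      monomial (mapLamEquiv φ).toEquiv z * W χ p := by
    change monomial (act p).toEquiv (wt χ p) * _ = _ * monomial (act p).toEquiv (wt χ p)
    rw [monomial_mul, monomial_mul]
    have h1 : ((act p).toEquiv * (mapLamEquiv φ).toEquiv : Equiv.Perm (Lam H)) =
        (mapLamEquiv φ).toEquiv * (act p).toEquiv :=
      Equiv.ext fun l => (mapLam_act φ p l).symm
    rw [h1]
    congr 1
    funext l
    exact (hact p l).symm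
  exact Subtype.ext (conjStarAlgAut_comm hcomm x.1)

/-- Every `φ` in `Aut(H, μ*μ, χ²)` is implemented by some automorphism commuting with `β`. -/
lemma exists_commutesBeta_implements (φ : AutH μ.starMul (χ ^ 2)) :
    ∃ α : AutVN (tildeLam μ), CommutesBeta χ α ∧ Implements α φ.toAddEquiv ∧
      ∀ x, ‖(α x).1 (delta 0)‖ = ‖x.1 (delta 0)‖ := by
  obtain ⟨f, hfμ, hfχ⟩ := φ
  obtain ⟨ζ, hζ0, hζ⟩ := exists_coboundary_of_starMul hfμ
  let η : AddChar H Circle := (χ.compAddMonoidHom f.toAddMonoidHom) * χ⁻¹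
  have hη' : ∀ h, η h = χ (f h) * (χ h)⁻¹ := fun h => by
    rw [← AddChar.inv_apply']
    rfl
  have hη : ∀ h, η h * χ h = χ (f h) := fun h => by rw [hη', inv_mul_cancel_right]
  have hη2 : ∀ h, η h ^ 2 = 1 := fun h => by
    have h1 : χ (f h) ^ 2 = χ h ^ 2 := hfχ h
    rw [hη', mul_pow, h1, inv_pow, mul_inv_cancel]
  have hz : ∀ a b : Lam H, phaseLam ζ η (a + b) * tildeLam μ a b =
      phaseLam ζ η a * phaseLam ζ η b * tildeLam μ (mapLamEquiv f a) (mapLamEquiv f b) :=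
    phaseLam_add η hζ0 hζ
  exact ⟨monomialAut hz, commutesBeta_monomialAut hz (phaseLam_act hζ0 hη hη2),
    fun l => ⟨_, scalarMaps_monomialAut hz l⟩, norm_monomialAut hz⟩

end Construction

/-! ### The topologies -/

section Topologies

open Filter Topology

lemma tendsto_twoNorm_iff {G : Type*} [AddCommGroup G] {ν : Cocycle G} {X : Type*} {l : Filter X}
    {f : X → LVN ν} {x : LVN ν} :
    Tendsto f l (@nhds _ (twoNormTopology ν) x) ↔
      ∀ ε > 0, ∀ᶠ a in l, ‖(f a - x).1 (delta 0)‖ < ε := by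
  let := (twoNorm ν).toSeminormedAddCommGroup.toPseudoMetricSpace
  have hdist : ∀ y : LVN ν, dist y x = ‖(y - x).1 (delta 0)‖ := by
    intro y
    rw [dist_comm]
    change √(tr ν (star (-x + y) * (-x + y))).re = _
    rw [sqrt_tr, neg_add_eq_sub]
  refine Metric.tendsto_nhds.trans ?_
  simp only [hdist]

variable {H : Type*} [AddCommGroup H]

section AutH

variable {b : H → H → Circle} {χ : AddChar H Circle}

lemma eventually_autH_apply (φ₀ : AutH b χ) (g : H) :
    ∀ᶠ φ : AutH b χ in 𝓝 φ₀, φ.toAddEquiv g = φ₀.toAddEquiv g := by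
  let : TopologicalSpace H := ⊥
  have : DiscreteTopology H := ⟨rfl⟩
  have h : Continuous fun φ : AutH b χ => φ.toAddEquiv g :=
    continuous_iInf_dom (i := g) continuous_induced_dom
  have h2 := h.tendsto φ₀
  rwa [nhds_discrete H, tendsto_pure] at h2

lemma continuous_autH {X : Type*} [TopologicalSpace X] {f : X → AutH b χ}
    (hf : ∀ x₀ g, ∀ᶠ x in 𝓝 x₀, (f x).toAddEquiv g = (f x₀).toAddEquiv g) : Continuous f := by
  refine continuous_iInf_rng.2 fun g => continuous_induced_rng.2 ?_
  let : TopologicalSpace H := ⊥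
  have : DiscreteTopology H := ⟨rfl⟩
  refine continuous_iff_continuousAt.2 fun x₀ => ?_
  rw [ContinuousAt, nhds_discrete H, tendsto_pure]
  exact hf x₀ g

lemma isTopologicalGroup_autH : IsTopologicalGroup (AutH b χ) where
  continuous_mul := by
    refine continuous_autH fun x₀ g => ?_
    have h1 := (continuous_snd.tendsto x₀).eventually (eventually_autH_apply x₀.2 g)
    have h2 := (continuous_fst.tendsto x₀).eventually
      (eventually_autH_apply x₀.1 (x₀.2.toAddEquiv g))
    filter_upwards [h1, h2] with x hx1 hx2
    change x.1.toAddEquiv (x.2.toAddEquiv g) = x₀.1.toAddEquiv (x₀.2.toAddEquiv g)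
    rw [hx1, hx2]
  continuous_inv := by
    refine continuous_autH fun φ₀ g => ?_
    filter_upwards [eventually_autH_apply φ₀ (φ₀.toAddEquiv.symm g)] with φ hφ
    change φ.toAddEquiv.symm g = φ₀.toAddEquiv.symm g
    rw [AddEquiv.symm_apply_eq, hφ, AddEquiv.apply_symm_apply]

end AutH

variable (μ : Cocycle H) (χ : AddChar H Circle)

/-- The automorphism of `N(H, μ)` underlying an element of the centralizer of `β`. -/
def toAut (π : Centralizer μ χ) : AutVN (tildeLam μ) := π.1

lemma toAut_injective : Function.Injective (toAut μ χ) := Subtype.val_injective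

lemma toAut_mul (π π' : Centralizer μ χ) :
    toAut μ χ (π * π') = (toAut μ χ π').trans (toAut μ χ π) := rfl

lemma commutesBeta_toAut (π : Centralizer μ χ) : CommutesBeta χ (toAut μ χ π) := π.2

lemma exists_toAut_eq {α : AutVN (tildeLam μ)} (hα : CommutesBeta χ α) :
    ∃ π : Centralizer μ χ, toAut μ χ π = α :=
  ⟨⟨α, hα⟩, rfl⟩

lemma continuous_toAut : Continuous (toAut μ χ) := continuous_subtype_val

lemma eventually_toAut (π₀ : Centralizer μ χ) (x : N μ) {ε : ℝ} (hε : 0 < ε) :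
    ∀ᶠ π : Centralizer μ χ in 𝓝 π₀, ‖(toAut μ χ π x - toAut μ χ π₀ x).1 (delta 0)‖ < ε := by
  let := twoNormTopology (tildeLam μ)
  have h1 : Continuous fun α : AutVN (tildeLam μ) => α x :=
    continuous_iInf_dom (i := x) continuous_induced_dom
  exact tendsto_twoNorm_iff.1 ((h1.comp (continuous_toAut μ χ)).tendsto π₀) ε hε

lemma continuous_of_toAut {X : Type*} [TopologicalSpace X] {f : X → Centralizer μ χ}
    (hf : ∀ x₀ y, ∀ ε > 0, ∀ᶠ x in 𝓝 x₀,
      ‖(toAut μ χ (f x) y - toAut μ χ (f x₀) y).1 (delta 0)‖ < ε) :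
    Continuous f := by
  refine continuous_induced_rng.2 (continuous_iInf_rng.2 fun y => continuous_induced_rng.2 ?_)
  let := twoNormTopology (tildeLam μ)
  exact continuous_iff_continuousAt.2 fun x₀ => tendsto_twoNorm_iff.2 (hf x₀ y)

end Topologies

/-! ### The isomorphism -/

section Isomorphism

open Filter Topology

variable {H : Type*} [AddCommGroup H] (μ : Cocycle H) (χ : AddChar H Circle)

/-- The automorphism `φ_π` of `H`, as an element of `Aut(H, μ*μ, χ²)`. -/
def autH (π : Centralizer μ χ) : AutH μ.starMul (χ ^ 2) where
  toAddEquiv := (exists_implements (commutesBeta_toAut μ χ π)).choose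
  map_b := (exists_implements (commutesBeta_toAut μ χ π)).choose_spec.starMul
  map_χ := (exists_implements (commutesBeta_toAut μ χ π)).choose_spec.char_sq
    (commutesBeta_toAut μ χ π)

lemma implements_autH (π : Centralizer μ χ) :
    Implements (toAut μ χ π) (autH μ χ π).toAddEquiv :=
  (exists_implements (commutesBeta_toAut μ χ π)).choose_spec

lemma autH_eq (π : Centralizer μ χ) {φ : AutH μ.starMul (χ ^ 2)}
    (h : Implements (toAut μ χ π) φ.toAddEquiv) : autH μ χ π = φ :=
  AutH.ext' fun g => DFunLike.congr_fun ((implements_autH μ χ π).unique h) g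

lemma autH_mul (π π' : Centralizer μ χ) : autH μ χ (π * π') = autH μ χ π * autH μ χ π' := by
  refine autH_eq μ χ (π * π') ?_
  rw [toAut_mul]
  exact (implements_autH μ χ π').trans (implements_autH μ χ π)

lemma autH_bijective : Function.Bijective (autH μ χ) := by
  refine ⟨fun π π' h => toAut_injective μ χ ?_, fun φ => ?_⟩
  · have h' := implements_autH μ χ π'
    have h2 : (autH μ χ π').toAddEquiv = (autH μ χ π).toAddEquiv :=
      congrArg AutH.toAddEquiv h.symm
    rw [h2] at h'
    have h1 := implements_autH μ χ π
    generalize (autH μ χ π).toAddEquiv = φ at h1 h'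
    exact Implements.aut_eq (commutesBeta_toAut μ χ π) (commutesBeta_toAut μ χ π') h1 h'
  · obtain ⟨α, hα, hφ, -⟩ := exists_commutesBeta_implements (μ := μ) (χ := χ) φ
    exact (exists_toAut_eq μ χ hα).imp fun π hπ => autH_eq μ χ π (hπ.symm.rec hφ)

/-- The elements of the centralizer preserve the `2`-norm, since the explicit ones do. -/
lemma norm_toAut_delta (π : Centralizer μ χ) (x : N μ) :
    ‖(toAut μ χ π x).1 (delta 0)‖ = ‖x.1 (delta 0)‖ := by
  obtain ⟨α, hα, hφ, hnorm⟩ := exists_commutesBeta_implements (autH μ χ π)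
  rw [Implements.aut_eq (commutesBeta_toAut μ χ π) hα (implements_autH μ χ π) hφ]
  exact hnorm x

/-- Unimodular multiples of distinct `u(a)` are at `2`-norm distance at least `1`. -/
lemma eq_of_norm_sub_lt_one {G : Type*} [AddCommGroup G] {ν : Cocycle G} {α α' : AutVN ν}
    {g a a' : G} {z z' : Circle} (h : ScalarMaps α g z a) (h' : ScalarMaps α' g z' a')
    (hlt : ‖(α (U ν g) - α' (U ν g)).1 (delta 0)‖ < 1) : a = a' := by
  by_contra hne
  have h1 : (α (U ν g) - α' (U ν g)).1 (delta 0) = (z : ℂ) • delta a - (z' : ℂ) • delta a' := by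
    rw [h, h', ← U_delta_zero ν a, ← U_delta_zero ν a']
    rfl
  have h2 := lp.norm_apply_le_norm (p := 2) (by simp) ((z : ℂ) • delta a - (z' : ℂ) • delta a') a
  have h3 : ((z : ℂ) • delta a - (z' : ℂ) • delta a' : L2 G) a = z := by
    change (z : ℂ) * delta a a - z' * delta a' a = z
    rw [delta_self, delta_of_ne hne, mul_one, mul_zero, sub_zero]
  rw [h3, Circle.norm_coe, ← h1] at h2
  exact absurd hlt h2.not_gt

lemma continuous_autH_map : Continuous (autH μ χ) := by
  refine continuous_autH fun π₀ g => ?_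
  refine (eventually_toAut μ χ π₀ (U (tildeLam μ) (edge g 0 e₁)) one_pos).mono fun π hπ => ?_
  obtain ⟨z, hz⟩ := (implements_autH μ χ π).exists_edge g 0 e₁
  obtain ⟨w, hw⟩ := (implements_autH μ χ π₀).exists_edge g 0 e₁
  exact edge_injective zero_ne_e₁ (eq_of_norm_sub_lt_one hz hw hπ)

lemma norm_sub_lt_of_approx {G : Type*} [AddCommGroup G] {ν : Cocycle G} {α α' : AutVN ν}
    (hα : ∀ x, ‖(α x).1 (delta 0)‖ = ‖x.1 (delta 0)‖)
    (hα' : ∀ x, ‖(α' x).1 (delta 0)‖ = ‖x.1 (delta 0)‖) {y : LVN ν} {s : Finset G} {c : G → ℂ}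
    {ε : ℝ} (hs : ‖(y - ∑ g ∈ s, c g • U ν g).1 (delta 0)‖ < ε / 2)
    (hU : ∀ g ∈ s, α (U ν g) = α' (U ν g)) : ‖(α y - α' y).1 (delta 0)‖ < ε := by
  set y' := ∑ g ∈ s, c g • U ν g with hy'
  have h2 : α y' = α' y' := by
    rw [hy', map_sum, map_sum]
    refine Finset.sum_congr rfl fun g hg => ?_
    rw [aut_smul, aut_smul, hU g hg]
  have h3 : α y - α' y = α (y - y') - α' (y - y') := by
    rw [map_sub, map_sub, h2, sub_sub_sub_cancel_right]
  rw [h3]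
  refine (norm_sub_le ((α (y - y')).1 (delta 0)) ((α' (y - y')).1 (delta 0))).trans_lt ?_
  rw [hα, hα']
  linarith only [hs]

/-- On each `u(λ)`, the inverse of `π ↦ φ_π` is locally constant; by density of their span and
invariance of the `2`-norm, it is continuous. -/
lemma continuous_of_autH_comp {X : Type*} [TopologicalSpace X] {f : X → Centralizer μ χ}
    (hf : Continuous fun x => autH μ χ (f x)) : Continuous f := by
  refine continuous_of_toAut μ χ fun x₀ y ε hε => ?_
  obtain ⟨s, hs⟩ := exists_finset_norm_sub_lt y (half_pos hε)
  have h1 : ∀ l ∈ s, ∀ᶠ x in 𝓝 x₀, toAut μ χ (f x) (U (tildeLam μ) l) =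
      toAut μ χ (f x₀) (U (tildeLam μ) l) := by
    intro l _
    obtain ⟨F, hF⟩ := exists_finset_aut_U_eq μ χ l
    have h2 := (Filter.eventually_all_finset F).2 fun h _ =>
      (hf.tendsto x₀).eventually (eventually_autH_apply (autH μ χ (f x₀)) h)
    exact h2.mono fun x hx => hF _ _ _ _ (commutesBeta_toAut μ χ _) (commutesBeta_toAut μ χ _)
      (implements_autH μ χ _) (implements_autH μ χ _) hx
  exact ((Filter.eventually_all_finset s).2 h1).mono fun x hx =>
    norm_sub_lt_of_approx (norm_toAut_delta μ χ _) (norm_toAut_delta μ χ _) hs hx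

lemma continuous_autH_symm :
    Continuous (Equiv.ofBijective (autH μ χ) (autH_bijective μ χ)).symm := by
  refine continuous_of_autH_comp μ χ ?_
  have h : (fun φ => autH μ χ ((Equiv.ofBijective (autH μ χ) (autH_bijective μ χ)).symm φ)) = id :=
    funext (Equiv.ofBijective_apply_symm_apply _ (autH_bijective μ χ))
  rw [h]
  exact continuous_id

/-- The map `π ↦ φ_π` as an isomorphism of groups and a homeomorphism. -/
def autHEquiv : Centralizer μ χ ≃ₜ* AutH μ.starMul (χ ^ 2) where
  toEquiv := Equiv.ofBijective (autH μ χ) (autH_bijective μ χ)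
  map_mul' := autH_mul μ χ
  continuous_toFun := continuous_autH_map μ χ
  continuous_invFun := continuous_autH_symm μ χ

end Isomorphism

end TwistedBernoulli

end

open TwistedBernoulli in
theorem theorem4p4 {H : Type*} [AddCommGroup H] [Countable H] [Nontrivial H]
    (μ : Cocycle H) (χ : AddChar H Circle) :
    (∀ π : Centralizer μ χ, ∃! φ : AutH μ.starMul (χ ^ 2),
      ∀ l : Lam H, ∃ z : Circle,
        π.1 (U (tildeLam μ) l) = (z : ℂ) • U (tildeLam μ) (mapLam φ.toAddEquiv l)) ∧
    IsTopologicalGroup (Centralizer μ χ) ∧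
    IsTopologicalGroup (AutH μ.starMul (χ ^ 2)) ∧
    ∃ Φ : Centralizer μ χ ≃ₜ* AutH μ.starMul (χ ^ 2),
      ∀ (π : Centralizer μ χ) (l : Lam H), ∃ z : Circle,
        π.1 (U (tildeLam μ) l) = (z : ℂ) • U (tildeLam μ) (mapLam (Φ π).toAddEquiv l) := by
  refine ⟨fun π => ⟨autH μ χ π, implements_autH μ χ π, fun φ hφ => (autH_eq μ χ π hφ).symm⟩,
    ?_, isTopologicalGroup_autH, autHEquiv μ χ, implements_autH μ χ⟩
  have : IsTopologicalGroup (AutH μ.starMul (χ ^ 2)) := isTopologicalGroup_autH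
  exact (autHEquiv μ χ).toHomeomorph.isInducing.topologicalGroup (autHEquiv μ χ)
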